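/- Let $k\ge 1$, let $c(x)=x^3+c_2x^2+c_1x+c_0\in\mathbb R[x]$ be a monic cubic such that $P(x,y)=xy-c(x)$ is irreducible (equivalently $c_0\neq 0$), and let $C=\{P=0\}\subset\mathbb R^2$, with vanishing ideal $I\subset\mathbb R[x,y]$ and coordinate ring $\mathbb R[C]=\mathbb R[x,y]/I$. Write $\mathbb R[C]_{\le m}$ for the image of $\mathbb R[x,y]_{\le m}$ (total degree at most $m$) in $\mathbb R[C]$, and $I_{\le m}=I\cap\mathbb R[x,y]_{\le m}$. Let $V^{(k)}\subset\mathbb R[C]$ be the linear span of $$\big(\{x^ay^b: 0\le a\le 2,\ b\ge 0,\ a+b\le k\}\setminus\{y^k\}\big)\cup\{y^k-2x^{2k}\};$$ products of two elements of $V^{(k)}$ lie in $\mathbb R[C]_{\le 2k}$. Let $\Phi:\mathbb R[C]\to\mathbb R[t,t^{-1}]$ be the homomorphism $\Phi(p(x,y))=p\big(t,\tfrac{c(t)}{t}\big)$, let $d_k(t)=c(t)^k-2t^{3k}$, and $$\mathcal B_{\mathcal Q}=\Big\{\tfrac{c^k}{t^k},\tfrac{c^{k-1}}{t^{k-1}},\dots,\tfrac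 ct,1,t,\dots,t^{2k-1}\Big\},\qquad \mathcal B_{\mathcal R}=\Big\{\tfrac{d_k}{t^k},\tfrac{c^{k-1}}{t^{k-1}},\dots,\tfrac ct,1,t,\dots,t^{2k-1}\Big\}.$$ Let $L:\mathbb R[x,y]_{\le 2k}\to\mathbb R$ be a linear functional vanishing on $I_{\le 2k}$, let $L_C:\mathbb R[C]_{\le 2k}\to\mathbb R$ be the induced functional, and let $$\overline L(p,q)=L(pq)\ \text{ on }\mathbb R[x,y]_{\le k},\qquad \overline L_C(f,g)=L_C(fg)\ \text{ on }\mathbb R[C]_{\le k},\qquad \overline L_{C,V^{(k)},1}(g,h)=L_C(gh)\ \text{ on }V^{(k)}.$$ Assume that $L$ is $C$-singular, i.e. it is not the case that both $\ker\overline L=I_{\le k}$ and $\ker\overline L_{C,V^{(k)},1}=\{0\}$. Then the following are equivalent: 1. $L$ is a $C$-moment functional, i.e. there is a positive Borel measure $\mu$ on $\mathbb R^2$ supported on $C$ such that every $p\in\mathbb R[x,y]_{\le 2k}$ is $\mu$-integrable and $L(p)=\int_C p\,d\mu$. 2. $L_C$ is square positive ($L_C(f^2)\ge 0$ for all $f\in\mathbb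 R[C]_{\le k}$) and $(V^{(k)},1)$-locally square positive ($L_C(g^2)\ge 0$ for all $g\in V^{(k)}$), and at least one of the following holds: (a) for $U=\operatorname{Lin}\big(\Phi^{-1}(\mathcal B_{\mathcal Q}\setminus\{c^k/t^k\})\big)$ one has $\operatorname{rank}\overline L_C=\operatorname{rank}\big(\overline L_C|_U\big)$; (b) for $W=\operatorname{Lin}\big(\Phi^{-1}(\mathcal B_{\mathcal R}\setminus\{d_k/t^k\})\big)$ one has $\operatorname{rank}\overline L_{C,V^{(k)},1}=\operatorname{rank}\big(\overline L_{C,V^{(k)},1}|_W\big)$. -/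

import Mathlib

open scoped LaurentPolynomial

noncomputable section

namespace CubicTMP

/-! ### Truncated functionals on a plane set -/

/-- `ℝ[x,y]_{≤ m}`: bivariate real polynomials of total degree at most `m`. -/
abbrev PolyLE (m : ℕ) : Submodule ℝ (MvPolynomial (Fin 2) ℝ) :=
  MvPolynomial.restrictTotalDegree (Fin 2) ℝ m

/-- The vanishing ideal of a plane set `S`. -/
abbrev vanIdeal (S : Set (Fin 2 → ℝ)) : Ideal (MvPolynomial (Fin 2) ℝ) :=
  MvPolynomial.vanishingIdeal ℝ S

/-- `ℝ[S] = ℝ[x,y] / I(S)`, the ring of polynomial functions on `S`. -/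
abbrev CoordRing (S : Set (Fin 2 → ℝ)) : Type :=
  MvPolynomial (Fin 2) ℝ ⧸ vanIdeal S

/-- The restriction map `ℝ[x,y] → ℝ[S]`. -/
abbrev resMap (S : Set (Fin 2 → ℝ)) : MvPolynomial (Fin 2) ℝ →ₐ[ℝ] CoordRing S :=
  Ideal.Quotient.mkₐ ℝ (vanIdeal S)

/-- `ℝ[S]_{≤ m}`, the image of `ℝ[x,y]_{≤ m}` in `ℝ[S]`. -/
def CoordLE (S : Set (Fin 2 → ℝ)) (m : ℕ) : Submodule ℝ (CoordRing S) :=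
  (PolyLE m).map (resMap S).toLinearMap

/-- `I(S)_{≤ m}`, as a subspace of `ℝ[x,y]_{≤ m}`. -/
def idealLE (S : Set (Fin 2 → ℝ)) (m : ℕ) : Submodule ℝ (PolyLE m) :=
  ((vanIdeal S).restrictScalars ℝ).comap (PolyLE m).subtype

/-- `L` is an `S`-moment functional: it is integration against a (positive) Borel measure on the
plane which is carried by `S`, all polynomials of the relevant degree being integrable. -/
def IsMomentFunctional (S : Set (Fin 2 → ℝ)) {m : ℕ} (L : PolyLE m →ₗ[ℝ] ℝ) : Prop :=
  ∃ μ : MeasureTheory.Measure (Fin 2 → ℝ), μ Sᶜ = 0 ∧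
    ∀ p : PolyLE m,
      MeasureTheory.Integrable (fun z => MvPolynomial.eval z (p : MvPolynomial (Fin 2) ℝ)) μ ∧
      L p = ∫ z, MvPolynomial.eval z (p : MvPolynomial (Fin 2) ℝ) ∂μ

/-- `L` vanishes on `I(S)_{≤ m}`, i.e. the induced functional on `ℝ[S]_{≤ m}` is well defined. -/
def VanishesOnIdeal (S : Set (Fin 2 → ℝ)) {m : ℕ} (L : PolyLE m →ₗ[ℝ] ℝ) : Prop :=
  idealLE S m ≤ LinearMap.ker L

theorem mul_mem_polyLE {a b : ℕ} {p q : MvPolynomial (Fin 2) ℝ}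
    (hp : p ∈ PolyLE a) (hq : q ∈ PolyLE b) : p * q ∈ PolyLE (a + b) := by
  rw [MvPolynomial.mem_restrictTotalDegree] at *
  exact (MvPolynomial.totalDegree_mul p q).trans (add_le_add hp hq)

theorem mul_mem_coordLE {S : Set (Fin 2 → ℝ)} {a b : ℕ} {f g : CoordRing S}
    (hf : f ∈ CoordLE S a) (hg : g ∈ CoordLE S b) : f * g ∈ CoordLE S (a + b) := by
  obtain ⟨p, hp, rfl⟩ := hf
  obtain ⟨q, hq, rfl⟩ := hg
  exact ⟨p * q, mul_mem_polyLE hp hq, map_mul (resMap S) p q⟩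

theorem coordLE_mono (S : Set (Fin 2 → ℝ)) {a b : ℕ} (h : a ≤ b) : CoordLE S a ≤ CoordLE S b := by
  rintro _ ⟨p, hp, rfl⟩
  refine ⟨p, ?_, rfl⟩
  simp only [SetLike.mem_coe, MvPolynomial.mem_restrictTotalDegree] at *
  omega

/-- The restriction map `ℝ[x,y]_{≤ m} → ℝ[S]_{≤ m}`. -/
def resLE (S : Set (Fin 2 → ℝ)) (m : ℕ) : PolyLE m →ₗ[ℝ] CoordLE S m :=
  (resMap S).toLinearMap.restrict fun p hp => ⟨p, hp, rfl⟩

theorem resLE_surjective (S : Set (Fin 2 → ℝ)) (m : ℕ) : Function.Surjective (resLE S m) := by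
  rintro ⟨_, p, hp, rfl⟩
  exact ⟨⟨p, hp⟩, rfl⟩

theorem ker_resLE (S : Set (Fin 2 → ℝ)) (m : ℕ) : LinearMap.ker (resLE S m) = idealLE S m := by
  ext p
  rw [LinearMap.mem_ker, Subtype.ext_iff]
  exact Ideal.Quotient.eq_zero_iff_mem

/-- The induced functional `L_S : ℝ[S]_{≤ m} → ℝ`, `L_S (p + I(S)) = L p`. -/
def inducedFunctional {S : Set (Fin 2 → ℝ)} {m : ℕ} (L : PolyLE m →ₗ[ℝ] ℝ)
    (hL : VanishesOnIdeal S L) : CoordLE S m →ₗ[ℝ] ℝ :=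
  ((LinearMap.ker (resLE S m)).liftQ L (by rw [ker_resLE]; exact hL)).comp
    ((resLE S m).quotKerEquivOfSurjective (resLE_surjective S m)).symm.toLinearMap

theorem inducedFunctional_resLE {S : Set (Fin 2 → ℝ)} {m : ℕ} (L : PolyLE m →ₗ[ℝ] ℝ)
    (hL : VanishesOnIdeal S L) (p : PolyLE m) : inducedFunctional L hL (resLE S m p) = L p := by
  simp [inducedFunctional, LinearMap.quotKerEquivOfSurjective_symm_apply]

/-! ### The bilinear forms -/

/-- The bilinear form `(p, q) ↦ L (p q)` on `ℝ[x,y]_{≤ k}`. -/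
def polyForm {k : ℕ} (L : PolyLE (2 * k) →ₗ[ℝ] ℝ) : LinearMap.BilinForm ℝ (PolyLE k) :=
  LinearMap.mk₂ ℝ
    (fun p q => L ⟨(p : MvPolynomial (Fin 2) ℝ) * q, two_mul k ▸ mul_mem_polyLE p.2 q.2⟩)
    (fun p p' q => by rw [← map_add]; congr 1; ext1; simp [add_mul])
    (fun a p q => by rw [← map_smul]; congr 1; ext1; simp)
    (fun p q q' => by rw [← map_add]; congr 1; ext1; simp [mul_add])
    (fun a p q => by rw [← map_smul]; congr 1; ext1; simp)

/-- For a functional `ℓ` on `ℝ[S]_{≤ n}`, a subspace `V` of `ℝ[S]` and `f ∈ ℝ[S]` such that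
`f g h ∈ ℝ[S]_{≤ n}` for all `g, h ∈ V`: the bilinear form `(g, h) ↦ ℓ (f g h)` on `V`. -/
def localForm {S : Set (Fin 2 → ℝ)} {n : ℕ} (ℓ : CoordLE S n →ₗ[ℝ] ℝ)
    (V : Submodule ℝ (CoordRing S)) (f : CoordRing S)
    (hV : ∀ g ∈ V, ∀ h ∈ V, f * (g * h) ∈ CoordLE S n) : LinearMap.BilinForm ℝ V :=
  LinearMap.mk₂ ℝ
    (fun g h => ℓ ⟨f * ((g : CoordRing S) * h), hV g g.2 h h.2⟩)
    (fun g g' h => by rw [← map_add]; congr 1; ext1; simp [add_mul, mul_add])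
    (fun a g h => by rw [← map_smul]; congr 1; ext1; simp [smul_mul_assoc, mul_smul_comm])
    (fun g h h' => by rw [← map_add]; congr 1; ext1; simp [mul_add])
    (fun a g h => by rw [← map_smul]; congr 1; ext1; simp [mul_smul_comm])

theorem one_mul_mul_mem_coordLE {S : Set (Fin 2 → ℝ)} {k : ℕ} :
    ∀ g ∈ CoordLE S k, ∀ h ∈ CoordLE S k, 1 * (g * h) ∈ CoordLE S (2 * k) := by
  intro g hg h hh
  rw [one_mul, two_mul]
  exact mul_mem_coordLE hg hh

/-- The bilinear form `(f, g) ↦ ℓ (f g)` on `ℝ[S]_{≤ k}`. -/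
def coordForm {S : Set (Fin 2 → ℝ)} {k : ℕ} (ℓ : CoordLE S (2 * k) →ₗ[ℝ] ℝ) :
    LinearMap.BilinForm ℝ (CoordLE S k) :=
  localForm ℓ (CoordLE S k) 1 one_mul_mul_mem_coordLE

/-- `B(g, g) ≥ 0` for every `g ≠ 0`. For `coordForm` this is square positivity, and for
`localForm ℓ V f` it is `(V, f)`-local square positivity. -/
def SquarePositive {E : Type*} [AddCommGroup E] [Module ℝ E] (B : LinearMap.BilinForm ℝ E) : Prop :=
  ∀ g : E, g ≠ 0 → 0 ≤ B g g

/-- The kernel `{v | B(u, v) = 0 for all u}` of a bilinear form. -/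
def formKer {E : Type*} [AddCommGroup E] [Module ℝ E] (B : LinearMap.BilinForm ℝ E) :
    Submodule ℝ E :=
  LinearMap.ker (LinearMap.flip B)

/-- The rank of a bilinear form on `E`, i.e. the rank of the map `E → E*` it defines. -/
def formRank {E : Type*} [AddCommMonoid E] [Module ℝ E] (B : LinearMap.BilinForm ℝ E) : Cardinal :=
  LinearMap.rank B

/-- The restriction of a bilinear form on `V` to a subspace `U ⊆ V`, both `U` and `V` being given
as subspaces of an ambient space. -/
def formRestrict {E : Type*} [AddCommGroup E] [Module ℝ E] {V : Submodule ℝ E}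
    (B : LinearMap.BilinForm ℝ V) (U : Submodule ℝ E) :
    LinearMap.BilinForm ℝ (U.comap V.subtype) :=
  LinearMap.BilinForm.restrict B (U.comap V.subtype)

/-! ### The curve `x y = c(x)` -/

/-- The polynomial `x y - c(x)`. -/
def curvePoly (c : Polynomial ℝ) : MvPolynomial (Fin 2) ℝ :=
  MvPolynomial.X 0 * MvPolynomial.X 1 - Polynomial.aeval (MvPolynomial.X 0) c

/-- The zero set of `x y - c(x)` in the plane. -/
def curve (c : Polynomial ℝ) : Set (Fin 2 → ℝ) :=
  {z | MvPolynomial.eval z (curvePoly c) = 0}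

/-- The coordinate function `x` on the curve. -/
def xC (c : Polynomial ℝ) : CoordRing (curve c) := resMap (curve c) (MvPolynomial.X 0)

/-- The coordinate function `y` on the curve. -/
def yC (c : Polynomial ℝ) : CoordRing (curve c) := resMap (curve c) (MvPolynomial.X 1)

/-- The family `1, x, y, x², xy, y², …, x²y^{k-2}, xy^{k-1}, y^k`. -/
def basisSet (c : Polynomial ℝ) (k : ℕ) : Set (CoordRing (curve c)) :=
  {f | ∃ a b : ℕ, a ≤ 2 ∧ a + b ≤ k ∧ f = xC c ^ a * yC c ^ b}

/-- The space `V^{(k)}`, spanned by `basisSet` with `y^k` replaced by `y^k - 2 x^{2k}`. -/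
def Vk (c : Polynomial ℝ) (k : ℕ) : Submodule ℝ (CoordRing (curve c)) :=
  Submodule.span ℝ ((basisSet c k \ {yC c ^ k}) ∪ {yC c ^ k - 2 * xC c ^ (2 * k)})

/-- The relation `x y = c(x)` in the coordinate ring. -/
theorem xC_mul_yC (c : Polynomial ℝ) : xC c * yC c = Polynomial.aeval (xC c) c := by
  have h : curvePoly c ∈ vanIdeal (curve c) := by
    rw [MvPolynomial.mem_vanishingIdeal_iff]
    intro z hz
    rw [MvPolynomial.aeval_eq_eval]
    exact hz
  have h2 : resMap (curve c) (curvePoly c) = 0 := Ideal.Quotient.eq_zero_iff_mem.2 h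
  rw [curvePoly, map_sub, map_mul, ← Polynomial.aeval_algHom_apply, sub_eq_zero] at h2
  exact h2

theorem monomial_mem_coordLE (c : Polynomial ℝ) {a b k : ℕ} (h : a + b ≤ k) :
    xC c ^ a * yC c ^ b ∈ CoordLE (curve c) k := by
  refine ⟨MvPolynomial.X 0 ^ a * MvPolynomial.X 1 ^ b, ?_, ?_⟩
  · simp only [SetLike.mem_coe, MvPolynomial.mem_restrictTotalDegree]
    refine (MvPolynomial.totalDegree_mul _ _).trans ?_
    rw [MvPolynomial.totalDegree_X_pow, MvPolynomial.totalDegree_X_pow]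
    exact h
  · simp [xC, yC]

theorem xC_pow_mem (c : Polynomial ℝ) (hc : c.Monic) (hd : c.natDegree = 3) (m : ℕ) :
    ∀ j < 2 * m, xC c ^ j ∈ CoordLE (curve c) m := by
  induction m with
  | zero => intro j hj; omega
  | succ m ih =>
    have hx : xC c ∈ CoordLE (curve c) 1 := by
      simpa using monomial_mem_coordLE c (a := 1) (b := 0) (k := 1) le_rfl
    have hy : yC c ∈ CoordLE (curve c) 1 := by
      simpa using monomial_mem_coordLE c (a := 0) (b := 1) (k := 1) le_rfl
    have hlow : ∀ j < 2 * m + 1, xC c ^ j ∈ CoordLE (curve c) (m + 1) := by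
      intro j hj
      rcases j with _ | j
      · exact coordLE_mono _ (Nat.zero_le _)
          (by simpa using monomial_mem_coordLE c (a := 0) (b := 0) (k := 0) le_rfl)
      · rw [pow_succ]
        exact mul_mem_coordLE (ih j (by omega)) hx
    intro j hj
    by_cases hj' : j < 2 * m + 1
    · exact hlow j hj'
    obtain rfl : j = 2 * m + 1 := by omega
    rcases m with _ | m
    · simpa using hx
    have h3 : xC c ^ 3 = xC c * yC c - c.coeff 2 • xC c ^ 2 - c.coeff 1 • xC c ^ 1
        - c.coeff 0 • xC c ^ 0 := by
      have h1 : c.coeff 3 = 1 := hd ▸ hc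
      rw [xC_mul_yC, Polynomial.aeval_eq_sum_range, hd]
      simp only [Finset.sum_range_succ, Finset.sum_range_zero, h1, one_smul]
      abel
    have h4 : xC c ^ (2 * (m + 1) + 1) = xC c ^ (2 * m + 1) * yC c
        - c.coeff 2 • xC c ^ (2 * m + 2) - c.coeff 1 • xC c ^ (2 * m + 1)
        - c.coeff 0 • xC c ^ (2 * m) := by
      have : xC c ^ (2 * (m + 1) + 1) = xC c ^ (2 * m) * xC c ^ 3 := by ring
      rw [this, h3]
      simp only [mul_sub, mul_smul_comm, ← pow_add, add_zero]
      ring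
    rw [h4]
    refine sub_mem (sub_mem (sub_mem ?_ ?_) ?_) ?_
    · exact mul_mem_coordLE (ih _ (by omega)) hy
    · exact Submodule.smul_mem _ _ (hlow _ (by omega))
    · exact Submodule.smul_mem _ _ (hlow _ (by omega))
    · exact Submodule.smul_mem _ _ (hlow _ (by omega))

theorem aeval_xC_mem (c : Polynomial ℝ) (hc : c.Monic) (hd : c.natDegree = 3) (m : ℕ)
    (q : Polynomial ℝ) (hq : q.natDegree < 2 * m) :
    Polynomial.aeval (xC c) q ∈ CoordLE (curve c) m := by
  rw [Polynomial.aeval_eq_sum_range]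
  refine Submodule.sum_mem _ fun i hi => Submodule.smul_mem _ _ (xC_pow_mem c hc hd m i ?_)
  rw [Finset.mem_range] at hi
  omega

theorem yC_pow_mul_xC_pow (c : Polynomial ℝ) (a b : ℕ) :
    xC c ^ (a + b) * yC c ^ b = Polynomial.aeval (xC c) (Polynomial.X ^ a * c ^ b) := by
  rw [pow_add, mul_assoc, ← mul_pow, xC_mul_yC]
  simp

/-- Products of two elements of `V^{(k)}` lie in `ℝ[C]_{≤ 2k}`. -/
theorem one_mul_mul_mem_of_Vk (c : Polynomial ℝ) (hc : c.Monic) (hd : c.natDegree = 3) {k : ℕ}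
    (hk : 1 ≤ k) :
    ∀ g ∈ Vk c k, ∀ h ∈ Vk c k, 1 * (g * h) ∈ CoordLE (curve c) (2 * k) := by
  have hmix : ∀ s ∈ basisSet c k \ {yC c ^ k},
      s * (yC c ^ k - 2 * xC c ^ (2 * k)) ∈ CoordLE (curve c) (2 * k) := by
    rintro s ⟨⟨a, b, ha, hab, rfl⟩, hne⟩
    have hb : b < k := by
      by_contra hb
      obtain rfl : a = 0 := by omega
      obtain rfl : b = k := by omega
      simp at hne
    have e : xC c ^ a * yC c ^ b * (yC c ^ k - 2 * xC c ^ (2 * k)) =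
        xC c ^ a * yC c ^ (b + k) -
          (2 : ℝ) • Polynomial.aeval (xC c) (Polynomial.X ^ (2 * k + a - b) * c ^ b) := by
      rw [← yC_pow_mul_xC_pow, show 2 * k + a - b + b = 2 * k + a by omega, two_smul]
      ring
    rw [e]
    refine sub_mem (monomial_mem_coordLE c (by omega)) (Submodule.smul_mem _ _ ?_)
    apply aeval_xC_mem c hc hd
    refine lt_of_le_of_lt Polynomial.natDegree_mul_le ?_
    rw [Polynomial.natDegree_X_pow, hc.natDegree_pow, hd]
    omega
  have hww : (yC c ^ k - 2 * xC c ^ (2 * k)) * (yC c ^ k - 2 * xC c ^ (2 * k)) ∈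
      CoordLE (curve c) (2 * k) := by
    have e : (yC c ^ k - 2 * xC c ^ (2 * k)) * (yC c ^ k - 2 * xC c ^ (2 * k)) =
        xC c ^ 0 * yC c ^ (2 * k) - (4 : ℝ) • Polynomial.aeval (xC c)
          (Polynomial.X ^ k * c ^ k - Polynomial.X ^ (4 * k)) := by
      rw [map_sub, ← yC_pow_mul_xC_pow, map_pow, Polynomial.aeval_X,
        show (4 : ℝ) = ((4 : ℕ) : ℝ) by norm_num, Nat.cast_smul_eq_nsmul, nsmul_eq_mul]
      push_cast
      ring
    rw [e]
    refine sub_mem (monomial_mem_coordLE c (by omega)) (Submodule.smul_mem _ _ ?_)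
    apply aeval_xC_mem c hc hd
    have hm : (Polynomial.X ^ k * c ^ k : Polynomial ℝ).Monic :=
      (Polynomial.monic_X_pow k).mul (hc.pow k)
    have hn : (Polynomial.X ^ k * c ^ k : Polynomial ℝ).natDegree = 4 * k := by
      rw [(Polynomial.monic_X_pow k).natDegree_mul (hc.pow k), Polynomial.natDegree_X_pow,
        hc.natDegree_pow, hd]
      ring
    have hlt := Polynomial.degree_sub_lt_left (p := Polynomial.X ^ k * c ^ k)
      (q := (Polynomial.X ^ (4 * k) : Polynomial ℝ))
      (by rw [Polynomial.degree_X_pow, Polynomial.degree_eq_natDegree hm.ne_zero, hn]) hm.ne_zero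
      (by rw [hm.leadingCoeff, (Polynomial.monic_X_pow _).leadingCoeff])
    by_cases h0 : (Polynomial.X ^ k * c ^ k - Polynomial.X ^ (4 * k) : Polynomial ℝ) = 0
    · rw [h0, Polynomial.natDegree_zero]
      omega
    · have := Polynomial.natDegree_lt_natDegree h0 hlt
      omega
  have hle : Vk c k * Vk c k ≤ CoordLE (curve c) (2 * k) := by
    rw [Vk, Submodule.span_mul_span, Submodule.span_le]
    rintro _ ⟨s, hs, t, ht, rfl⟩
    simp only [Set.mem_union, Set.mem_singleton_iff] at hs ht
    rcases hs with hs | rfl <;> rcases ht with ht | rfl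
    · obtain ⟨⟨a, b, -, hab, rfl⟩, -⟩ := hs
      obtain ⟨⟨a', b', -, hab', rfl⟩, -⟩ := ht
      rw [two_mul]
      exact mul_mem_coordLE (monomial_mem_coordLE c hab) (monomial_mem_coordLE c hab')
    · exact hmix s hs
    · have h := hmix t ht
      rw [mul_comm t] at h
      exact h
    · exact hww
  intro g hg h hh
  rw [one_mul]
  exact hle (Submodule.mul_mem_mul hg hh)

/-- The `(V^{(k)}, 1)`-localized bilinear form `(g, h) ↦ ℓ (g h)` on `V^{(k)}`. -/
def VkForm {c : Polynomial ℝ} (hc : c.Monic) (hd : c.natDegree = 3) {k : ℕ} (hk : 1 ≤ k)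
    (ℓ : CoordLE (curve c) (2 * k) →ₗ[ℝ] ℝ) : LinearMap.BilinForm ℝ (Vk c k) :=
  localForm ℓ (Vk c k) 1 (one_mul_mul_mem_of_Vk c hc hd hk)

/-- `L` (whose induced functional on `ℝ[C]_{≤ 2k}` is well defined) is `C`-nonsingular: the kernel
of the form `(p, q) ↦ L (p q)` on `ℝ[x,y]_{≤ k}` is `I(C)_{≤ k}`, and the kernel of the
`(V^{(k)}, 1)`-localized form is zero. -/
def IsNonsingular {c : Polynomial ℝ} (hc : c.Monic) (hd : c.natDegree = 3) {k : ℕ} (hk : 1 ≤ k)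
    (L : PolyLE (2 * k) →ₗ[ℝ] ℝ) (hL : VanishesOnIdeal (curve c) L) : Prop :=
  formKer (polyForm L) = idealLE (curve c) k ∧
    formKer (VkForm hc hd hk (inducedFunctional L hL)) = ⊥

/-- The Laurent polynomial `c(t) / t`. -/
def cDivT (c : Polynomial ℝ) : ℝ[T;T⁻¹] :=
  Polynomial.toLaurent c * LaurentPolynomial.T (-1)

/-- `p(x,y) ↦ p(t, c(t)/t)` on polynomials. -/
def preParam (c : Polynomial ℝ) : MvPolynomial (Fin 2) ℝ →ₐ[ℝ] ℝ[T;T⁻¹] :=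
  MvPolynomial.aeval ![LaurentPolynomial.T 1, cDivT c]

theorem eval_preParam (c : Polynomial ℝ) (u : ℝˣ) (p : MvPolynomial (Fin 2) ℝ) :
    LaurentPolynomial.eval₂ (RingHom.id ℝ) u (preParam c p) =
      MvPolynomial.eval ![(u : ℝ), c.eval (u : ℝ) * (u : ℝ)⁻¹] p := by
  induction p using MvPolynomial.induction_on with
  | C a =>
    simp only [preParam, MvPolynomial.aeval_C, MvPolynomial.eval_C]
    rw [← LaurentPolynomial.C_eq_algebraMap, LaurentPolynomial.eval₂_C, RingHom.id_apply]
  | add p q hp hq => simp only [map_add, hp, hq]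
  | mul_X p i hp =>
    rw [map_mul, map_mul, map_mul, hp]
    congr 1
    fin_cases i
    · simp [preParam, LaurentPolynomial.eval₂_T]
    · simp only [preParam, cDivT, MvPolynomial.aeval_X, MvPolynomial.eval_X]
      simp [LaurentPolynomial.eval₂_T, LaurentPolynomial.eval₂_toLaurent, Polynomial.eval₂_id]

theorem laurent_eq_zero_of_eval {f : ℝ[T;T⁻¹]}
    (h : ∀ u : ℝˣ, LaurentPolynomial.eval₂ (RingHom.id ℝ) u f = 0) : f = 0 := by
  obtain ⟨n, g, hg⟩ := f.exists_T_pow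
  have hg0 : g = 0 := by
    apply Polynomial.eq_zero_of_infinite_isRoot
    refine Set.Infinite.mono (s := Set.Ioi (0 : ℝ)) ?_ (Set.Ioi_infinite 0)
    intro t ht
    have hh := congrArg (LaurentPolynomial.eval₂ (RingHom.id ℝ) (Units.mk0 t (ne_of_gt ht))) hg
    rw [map_mul, h, zero_mul, LaurentPolynomial.eval₂_toLaurent, Polynomial.eval₂_id] at hh
    exact hh
  rw [hg0, map_zero] at hg
  exact ((LaurentPolynomial.isUnit_T (R := ℝ) (n : ℤ)).mul_left_eq_zero).1 hg.symm

theorem curve_param_mem (c : Polynomial ℝ) (u : ℝˣ) :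
    ![(u : ℝ), c.eval (u : ℝ) * (u : ℝ)⁻¹] ∈ curve c := by
  have h : ∀ z : Fin 2 → ℝ, MvPolynomial.eval z (Polynomial.aeval (MvPolynomial.X 0) c) =
      c.eval (z 0) := by
    intro z
    rw [← MvPolynomial.coe_aeval_eq_eval, RingHom.coe_coe, ← Polynomial.aeval_algHom_apply]
    simp [Polynomial.aeval_def, Polynomial.eval₂_id]
  have hu : (u : ℝ) ≠ 0 := u.ne_zero
  simp only [curve, curvePoly, Set.mem_ofPred_eq, map_sub, map_mul, MvPolynomial.eval_X, h]
  simp only [Matrix.cons_val_zero, Matrix.cons_val_one]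
  field_simp
  ring

theorem preParam_eq_zero (c : Polynomial ℝ) (p : MvPolynomial (Fin 2) ℝ)
    (hp : p ∈ vanIdeal (curve c)) : preParam c p = 0 := by
  apply laurent_eq_zero_of_eval
  intro u
  rw [eval_preParam]
  have := (MvPolynomial.mem_vanishingIdeal_iff.1 hp) _ (curve_param_mem c u)
  rwa [MvPolynomial.aeval_eq_eval] at this

/-- The homomorphism `Φ : ℝ[C] → ℝ[t, t⁻¹]`, `Φ(p(x,y)) = p(t, c(t)/t)`. -/
def Phi (c : Polynomial ℝ) : CoordRing (curve c) →ₐ[ℝ] ℝ[T;T⁻¹] :=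
  Ideal.Quotient.liftₐ (vanIdeal (curve c)) (preParam c) (preParam_eq_zero c)

/-- `(c/t)^k, (c/t)^{k-1}, …, c/t, 1, t, …, t^{2k-1}`. -/
def basisQ (c : Polynomial ℝ) (k : ℕ) : Set ℝ[T;T⁻¹] :=
  {f | ∃ j : ℕ, 1 ≤ j ∧ j ≤ k ∧ f = cDivT c ^ j} ∪
    {f | ∃ j : ℕ, j < 2 * k ∧ f = LaurentPolynomial.T (j : ℤ)}

/-- `d_k(t) / t^k`, where `d_k(t) = c(t)^k - 2 t^{3k}`. -/
def dDivT (c : Polynomial ℝ) (k : ℕ) : ℝ[T;T⁻¹] :=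
  Polynomial.toLaurent (c ^ k - 2 * Polynomial.X ^ (3 * k)) * LaurentPolynomial.T (-(k : ℤ))

/-- `d_k/t^k, (c/t)^{k-1}, …, c/t, 1, t, …, t^{2k-1}`. -/
def basisR (c : Polynomial ℝ) (k : ℕ) : Set ℝ[T;T⁻¹] :=
  {dDivT c k} ∪ {f | ∃ j : ℕ, 1 ≤ j ∧ j < k ∧ f = cDivT c ^ j} ∪
    {f | ∃ j : ℕ, j < 2 * k ∧ f = LaurentPolynomial.T (j : ℤ)}

/-- `U`, the span of `Φ⁻¹(basisQ \ {c^k/t^k})`. -/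
def Uk (c : Polynomial ℝ) (k : ℕ) : Submodule ℝ (CoordRing (curve c)) :=
  Submodule.span ℝ (Phi c ⁻¹' (basisQ c k \ {cDivT c ^ k}))

/-- `W`, the span of `Φ⁻¹(basisR \ {d_k/t^k})`. -/
def Wk (c : Polynomial ℝ) (k : ℕ) : Submodule ℝ (CoordRing (curve c)) :=
  Submodule.span ℝ (Phi c ⁻¹' (basisR c k \ {dDivT c k}))

end CubicTMP

end

noncomputable section

namespace CubicTMP

/-! ### Laurent polynomials with exponents in an interval -/

/-! Since `c_0 ≠ 0`, `Φ` is an isomorphism of `ℝ[C]` onto `ℝ[t, t⁻¹]`, and the points of `C`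
correspond to the nonzero reals. Put `γ = c_0^k`. Among the basis monomials only `y^k` reaches the
exponents `-k` and `2k`, so `ℝ[C]_{≤ k}` becomes the space of Laurent polynomials on `[-k, 2k]`
whose bottom coefficient is `γ` times the top one. Passing to `y^k - 2x^{2k}` changes the sign of
the top coefficient, so `V^{(k)}` becomes the same space with factor `-γ`. Squares from either space
satisfy the relation with factor `γ²` on `[-2k, 4k]`, which describes `ℝ[C]_{≤ 2k}`. Both `U` and
`W` become the inner band `[-k+1, 2k-1]`, so (a) and (b) each say that the kernel of the form
contains an `f` with nonzero top coefficient (`rank_eq_rank_formRestrict_iff`).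

Sufficiency (`exists_atomic_on_twisted`): let `f` be such a kernel element, with factor `s = ±γ`. A
multiple of `f` in the product space has its cofactor in the space of factor `s`, so the functional
kills it, and the functional extends to one annihilating the whole ideal `(f)`. Modulo `f` every
Laurent polynomial has a representative with the opposite factor `-s`, so square positivity of the
other form makes the extension nonnegative on all squares. A nonnegative functional killing a
nonzero ideal is a finite sum of point evaluations at nonzero reals
(`exists_atomic_representation`), which gives atoms on `C`.

Necessity: singularity yields a nonzero `f` with `∫ f² = 0`, so `f = 0` almost everywhere and every
admissible multiple of `f` integrates to zero. If the top coefficient of `f` is nonzero, `f` itself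
is the required kernel element; otherwise `f` lies in the inner band and has a multiple that is one
for (a) (`exists_mul_mem_twisted`). -/

/-- Laurent polynomials with exponents in `[a, b]`. -/
def band (a b : ℤ) : Submodule ℝ ℝ[T;T⁻¹] where
  carrier := {f | ∀ n, n < a ∨ b < n → f.coeff n = 0}
  add_mem' hf hg n hn := by simp [hf n hn, hg n hn]
  zero_mem' n _ := by simp
  smul_mem' r f hf n hn := by simp [hf n hn]

/-- Laurent polynomials with exponents in `[a, b]` whose extreme coefficients are proportional
with factor `s`. -/
def twisted (a b : ℤ) (s : ℝ) : Submodule ℝ ℝ[T;T⁻¹] where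
  carrier := {f | f ∈ band a b ∧ f.coeff a = s * f.coeff b}
  add_mem' hf hg := ⟨add_mem hf.1 hg.1, by simp [hf.2, hg.2, mul_add]⟩
  zero_mem' := ⟨zero_mem _, by simp⟩
  smul_mem' r f hf := ⟨Submodule.smul_mem _ _ hf.1, by simp [hf.2]; ring⟩

theorem band_mono {a b a' b' : ℤ} (ha : a' ≤ a) (hb : b ≤ b') : band a b ≤ band a' b' :=
  fun _ hf n hn => hf n (by omega)

theorem coeff_T_mul (i n : ℤ) (f : ℝ[T;T⁻¹]) :
    (LaurentPolynomial.T i * f).coeff n = f.coeff (n - i) := by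
  rw [AddMonoidAlgebra.coeff_mul_apply_left, LaurentPolynomial.T, AddMonoidAlgebra.coeff_single,
    Finsupp.sum_single_index] <;> simp [sub_eq_neg_add]

theorem T_mem_band {a b i : ℤ} (ha : a ≤ i) (hb : i ≤ b) :
    (LaurentPolynomial.T i : ℝ[T;T⁻¹]) ∈ band a b := by
  intro n hn
  rw [LaurentPolynomial.T_apply, if_neg (by omega)]

theorem coeff_mul_eq_sum (f g : ℝ[T;T⁻¹]) (n : ℤ) :
    (f * g).coeff n = f.coeff.sum fun i r => r * g.coeff (n - i) := by
  rw [AddMonoidAlgebra.coeff_mul_apply_left]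
  simp [sub_eq_neg_add]

theorem mul_mem_band {a b a' b' : ℤ} {f g : ℝ[T;T⁻¹]} (hf : f ∈ band a b) (hg : g ∈ band a' b') :
    f * g ∈ band (a + a') (b + b') := by
  intro n hn
  rw [coeff_mul_eq_sum]
  refine Finset.sum_eq_zero fun i _ => ?_
  by_cases hi : i < a ∨ b < i
  · simp [hf i hi]
  · simp [hg (n - i) (by omega)]

theorem coeff_mul_top {a b a' b' : ℤ} {f g : ℝ[T;T⁻¹]} (hf : f ∈ band a b) (hg : g ∈ band a' b') :
    (f * g).coeff (b + b') = f.coeff b * g.coeff b' := by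
  rw [coeff_mul_eq_sum, Finsupp.sum_eq_single b]
  · simp
  · intro i _ hi
    by_cases hi' : b < i
    · simp [hf i (Or.inr hi')]
    · simp [hg (b + b' - i) (by omega)]
  · simp

theorem coeff_mul_bot {a b a' b' : ℤ} {f g : ℝ[T;T⁻¹]} (hf : f ∈ band a b) (hg : g ∈ band a' b') :
    (f * g).coeff (a + a') = f.coeff a * g.coeff a' := by
  rw [coeff_mul_eq_sum, Finsupp.sum_eq_single a]
  · simp
  · intro i _ hi
    by_cases hi' : i < a
    · simp [hf i (Or.inl hi')]
    · simp [hg (a + a' - i) (by omega)]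
  · simp

theorem exists_extreme_coeff {f : ℝ[T;T⁻¹]} (hf : f ≠ 0) :
    ∃ a b : ℤ, f ∈ band a b ∧ f.coeff a ≠ 0 ∧ f.coeff b ≠ 0 := by
  have hne : f.coeff.support.Nonempty := by
    rw [Finsupp.support_nonempty_iff]
    simpa using hf
  refine ⟨f.coeff.support.min' hne, f.coeff.support.max' hne, ?_,
    Finsupp.mem_support_iff.1 (Finset.min'_mem _ _), Finsupp.mem_support_iff.1 (Finset.max'_mem _ _)⟩
  intro n hn
  by_contra h
  have h := Finsupp.mem_support_iff.2 h
  have h1 := Finset.min'_le _ _ h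
  have h2 := Finset.le_max' _ _ h
  omega

theorem pow_band {a b : ℤ} {f : ℝ[T;T⁻¹]} (hf : f ∈ band a b) (n : ℕ) :
    f ^ n ∈ band (n * a) (n * b) ∧ (f ^ n).coeff (n * a) = f.coeff a ^ n ∧
      (f ^ n).coeff (n * b) = f.coeff b ^ n := by
  induction n with
  | zero =>
    refine ⟨?_, ?_, ?_⟩
    · rw [pow_zero, ← LaurentPolynomial.T_zero]
      exact T_mem_band (by simp) (by simp)
    · rw [pow_zero, ← LaurentPolynomial.T_zero, LaurentPolynomial.T_apply]; simp
    · rw [pow_zero, ← LaurentPolynomial.T_zero, LaurentPolynomial.T_apply]; simp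
  | succ n ih =>
    have ha : ((n + 1 : ℕ) : ℤ) * a = n * a + a := by push_cast; ring
    have hb : ((n + 1 : ℕ) : ℤ) * b = n * b + b := by push_cast; ring
    rw [ha, hb, pow_succ, pow_succ, pow_succ]
    exact ⟨mul_mem_band ih.1 hf, by rw [coeff_mul_bot ih.1 hf, ih.2.1],
      by rw [coeff_mul_top ih.1 hf, ih.2.2]⟩

theorem mul_mem_twisted {a b a' b' : ℤ} {s s' : ℝ} {f g : ℝ[T;T⁻¹]} (hf : f ∈ twisted a b s)
    (hg : g ∈ twisted a' b' s') : f * g ∈ twisted (a + a') (b + b') (s * s') :=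
  ⟨mul_mem_band hf.1 hg.1, by
    rw [coeff_mul_bot hf.1 hg.1, coeff_mul_top hf.1 hg.1, hf.2, hg.2]; ring⟩

theorem sub_smul_mem_band_left {a b : ℤ} {f g : ℝ[T;T⁻¹]} (hf : f ∈ band a b)
    (hg : g ∈ band a b) (h : g.coeff a ≠ 0) :
    f - (f.coeff a / g.coeff a) • g ∈ band (a + 1) b := by
  intro n hn
  by_cases h' : n = a
  · subst h'; simp [h]
  · simp [hf n (by omega), hg n (by omega)]

theorem sub_smul_mem_band_right {a b : ℤ} {f g : ℝ[T;T⁻¹]} (hf : f ∈ band a b)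
    (hg : g ∈ band a b) (h : g.coeff b ≠ 0) :
    f - (f.coeff b / g.coeff b) • g ∈ band a (b - 1) := by
  intro n hn
  by_cases h' : n = b
  · subst h'; simp [h]
  · simp [hf n (by omega), hg n (by omega)]

/-! ### Division with remainder in bands and twisted bands -/

/-- Modulo a Laurent polynomial with nonzero extreme coefficients at `a` and `b`, every Laurent
polynomial has a representative with exponents in `[a, b]`. -/
theorem exists_band_add_mul {a b : ℤ} {f : ℝ[T;T⁻¹]} (hf : f ∈ band a b)
    (ha : f.coeff a ≠ 0) (hb : f.coeff b ≠ 0) (g : ℝ[T;T⁻¹]) :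
    ∃ s ∈ band a b, ∃ m, g = s + f * m := by
  have hright : ∀ n : ℕ, ∀ g ∈ band a (b + n), ∃ s ∈ band a b, ∃ m, g = s + f * m := by
    intro n
    induction n with
    | zero => intro g hg; exact ⟨g, by simpa using hg, 0, by simp⟩
    | succ n ih =>
      intro g hg
      have hT : LaurentPolynomial.T (n + 1 : ℤ) * f ∈ band a (b + (n + 1 : ℕ)) := by
        intro i hi
        rw [coeff_T_mul]
        exact hf _ (by push_cast at hi; omega)
      have hc : (LaurentPolynomial.T (n + 1 : ℤ) * f).coeff (b + (n + 1 : ℕ)) = f.coeff b := by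
        rw [coeff_T_mul]; congr 1; push_cast; ring
      obtain ⟨s, hs, m, hm⟩ := ih _ (band_mono le_rfl (by push_cast; omega)
        (sub_smul_mem_band_right hg hT (by rwa [hc])))
      rw [sub_eq_iff_eq_add] at hm
      refine ⟨s, hs, m + (g.coeff (b + (n + 1 : ℕ)) / f.coeff b) • LaurentPolynomial.T (n + 1 : ℤ),
        ?_⟩
      rw [hc] at hm
      rw [mul_add, mul_smul_comm, mul_comm f (LaurentPolynomial.T _), ← add_assoc]
      exact hm
  -- Shifts of `f` strip the bottom exponents one at a time; the remaining excess at the top is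
  -- handled by `hright`.
  have hleft : ∀ n : ℕ, ∀ g ∈ band (a - n) (b + n), ∃ s ∈ band a b, ∃ m, g = s + f * m := by
    intro n
    suffices h : ∀ l : ℕ, ∀ g ∈ band (a - l) (b + n), ∃ s ∈ band a b, ∃ m, g = s + f * m from h n
    intro l
    induction l with
    | zero => intro g hg; exact hright n g (by simpa using hg)
    | succ l ih =>
      intro g hg
      have hT : LaurentPolynomial.T (-(l + 1) : ℤ) * f ∈ band (a - (l + 1 : ℕ)) (b + n) := by
        intro i hi
        rw [coeff_T_mul]
        exact hf _ (by push_cast at hi; omega)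
      have hc : (LaurentPolynomial.T (-(l + 1) : ℤ) * f).coeff (a - (l + 1 : ℕ)) = f.coeff a := by
        rw [coeff_T_mul]; congr 1; push_cast; ring
      obtain ⟨s, hs, m, hm⟩ := ih _ (band_mono (by push_cast; omega) le_rfl
        (sub_smul_mem_band_left hg hT (by rwa [hc])))
      rw [sub_eq_iff_eq_add] at hm
      refine ⟨s, hs, m + (g.coeff (a - (l + 1 : ℕ)) / f.coeff a) •
        LaurentPolynomial.T (-(l + 1) : ℤ), ?_⟩
      rw [hc] at hm
      rw [mul_add, mul_smul_comm, mul_comm f (LaurentPolynomial.T _), ← add_assoc]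
      exact hm
  by_cases hg : g = 0
  · exact ⟨0, zero_mem _, 0, by simp [hg]⟩
  obtain ⟨i, j, hij, -, -⟩ := exists_extreme_coeff hg
  exact hleft ((a - i).toNat + (j - b).toNat) g (band_mono (by omega) (by omega) hij)

/-- If `f` has nonzero extreme coefficients at `a` and `b`, the multiples of `f` in a twisted band
have twisted cofactor. -/
theorem cofactor_mem_twisted {a b : ℤ} {s : ℝ} (hs : s ≠ 0) {f m : ℝ[T;T⁻¹]}
    (hf : f ∈ twisted a b s) (hb : f.coeff b ≠ 0)
    (hfm : f * m ∈ twisted (a + a) (b + b) (s * s)) : m ∈ twisted a b s := by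
  by_cases hm : m = 0
  · rw [hm]; exact zero_mem _
  have ha : f.coeff a ≠ 0 := by rw [hf.2]; exact mul_ne_zero hs hb
  -- Extreme coefficients multiply without cancellation, so the exponent range of `m` cannot exceed
  -- `[a, b]`.
  obtain ⟨i, j, hij, hi, hj⟩ := exists_extreme_coeff hm
  have h1 := coeff_mul_top hf.1 hij
  have h2 := coeff_mul_bot hf.1 hij
  have h3 : j ≤ b := by
    by_contra h
    rw [hfm.1 _ (by omega)] at h1
    exact mul_ne_zero hb hj h1.symm
  have h4 : a ≤ i := by
    by_contra h
    rw [hfm.1 _ (by omega)] at h2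
    exact mul_ne_zero ha hi h2.symm
  have hmb : m ∈ band a b := band_mono h4 h3 hij
  refine ⟨hmb, ?_⟩
  have h5 := hfm.2
  rw [coeff_mul_bot hf.1 hmb, coeff_mul_top hf.1 hmb, hf.2] at h5
  have : s * f.coeff b ≠ 0 := mul_ne_zero hs hb
  apply mul_left_cancel₀ this
  rw [h5]; ring

/-- For `s ≠ 0` the factors `s` and `-s` differ, so the band is the sum of the line through `f` and
the space of factor `-s`. This is what lets positivity of one form control squares modulo a kernel
element of the other. -/
theorem exists_twisted_add_mul {a b : ℤ} {s : ℝ} (hs : s ≠ 0) {f : ℝ[T;T⁻¹]}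
    (hf : f ∈ twisted a b s) (hb : f.coeff b ≠ 0) (g : ℝ[T;T⁻¹]) :
    ∃ r ∈ twisted a b (-s), ∃ m, g = r + f * m := by
  have ha : f.coeff a ≠ 0 := by rw [hf.2]; exact mul_ne_zero hs hb
  obtain ⟨r, hr, m, rfl⟩ := exists_band_add_mul hf.1 ha hb g
  -- Solution of `r_a - l s f_b = -s (r_b - l f_b)`.
  set l : ℝ := (r.coeff a + s * r.coeff b) / (2 * s * f.coeff b) with hl
  refine ⟨r - l • f, ⟨sub_mem hr (Submodule.smul_mem _ _ hf.1), ?_⟩, m + l • 1, ?_⟩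
  · simp only [AddMonoidAlgebra.coeff_sub, AddMonoidAlgebra.coeff_smul, Finsupp.coe_sub,
      Finsupp.coe_smul, Pi.sub_apply, Pi.smul_apply, smul_eq_mul, hf.2, hl]
    field_simp
    ring
  · rw [mul_add, mul_smul_comm, mul_one]; ring

/-- A nonzero Laurent polynomial has a multiple in any twisted band of larger width. -/
theorem exists_mul_mem_twisted {a b : ℤ} (s : ℝ) {f : ℝ[T;T⁻¹]}
    (hf : f ∈ band (a + 1) (b - 1)) (h0 : f ≠ 0) :
    ∃ m, f * m ∈ twisted a b s ∧ (f * m).coeff b ≠ 0 := by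
  obtain ⟨i, j, hij, hi, hj⟩ := exists_extreme_coeff h0
  have h3 : j ≤ b - 1 := by
    by_contra h
    exact hj (hf _ (by omega))
  have h4 : a + 1 ≤ i := by
    by_contra h
    exact hi (hf _ (by omega))
  have e : ∀ n, (f * ((f.coeff j)⁻¹ • LaurentPolynomial.T (b - j) +
      (s / f.coeff i) • LaurentPolynomial.T (a - i))).coeff n =
      (f.coeff j)⁻¹ * f.coeff (n - (b - j)) + s / f.coeff i * f.coeff (n - (a - i)) := by
    intro n
    rw [mul_add, mul_smul_comm, mul_smul_comm, mul_comm f, mul_comm f]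
    simp only [AddMonoidAlgebra.coeff_add, AddMonoidAlgebra.coeff_smul, Finsupp.coe_add,
      Finsupp.coe_smul, Pi.add_apply, Pi.smul_apply, smul_eq_mul, coeff_T_mul]
  -- One shift of `f` puts coefficient `1` at `b`, the other puts `s` at `a`. As `f` is supported
  -- strictly inside, neither shifted copy reaches the opposite end.
  refine ⟨(f.coeff j)⁻¹ • LaurentPolynomial.T (b - j) +
    (s / f.coeff i) • LaurentPolynomial.T (a - i), ?_, ?_⟩
  · refine ⟨?_, ?_⟩
    · intro n hn
      rw [e, hij (n - (b - j)) (by omega), hij (n - (a - i)) (by omega)]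
      simp
    · rw [e, e, hij (a - (b - j)) (by omega), hij (b - (a - i)) (by omega), sub_sub_cancel,
        sub_sub_cancel]
      field_simp
      ring
  · rw [e, hij (b - (a - i)) (by omega), sub_sub_cancel]
    simp [hj]

/-! ### Nonnegative functionals on Laurent polynomials with nontrivial kernel -/

/-- The map `t ↦ ℓ((ta + b)²)` is affine in `t` and bounded below, so its slope `2ℓ(ab)` vanishes.
-/
theorem apply_mul_eq_zero_of_apply_sq_eq_zero {ℓ : ℝ[T;T⁻¹] →ₗ[ℝ] ℝ}
    (hpos : ∀ a, 0 ≤ ℓ (a * a)) {a : ℝ[T;T⁻¹]} (ha : ℓ (a * a) = 0) (b : ℝ[T;T⁻¹]) :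
    ℓ (a * b) = 0 := by
  by_contra h
  have key : ∀ t : ℝ, 0 ≤ 2 * t * ℓ (a * b) + ℓ (b * b) := by
    intro t
    have h1 := hpos (t • a + b)
    have h2 : (t • a + b) * (t • a + b) = (t * t) • (a * a) + (2 * t) • (a * b) + b * b := by
      simp only [LaurentPolynomial.smul_eq_C_mul, map_mul, map_ofNat]
      ring
    rw [h2, map_add, map_add, map_smul, map_smul, ha, smul_zero, zero_add, smul_eq_mul] at h1
    exact h1
  have h1 := key (-(ℓ (b * b) + 1) / (2 * ℓ (a * b)))
  have h2 : 2 * (-(ℓ (b * b) + 1) / (2 * ℓ (a * b))) * ℓ (a * b) = -(ℓ (b * b) + 1) := by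
    field_simp
  linarith

open Polynomial in
/-- A nonnegative functional annihilating a nonzero ideal annihilates an ideal generated by a
product of distinct real linear factors. -/
theorem exists_nodal_annihilated (n : ℕ) : ∀ (ℓ : ℝ[T;T⁻¹] →ₗ[ℝ] ℝ) (_ : ∀ a, 0 ≤ ℓ (a * a))
    (F : ℝ[X]) (_ : F ≠ 0) (_ : F.natDegree = n) (_ : ∀ a, ℓ (toLaurent F * a) = 0),
    ∃ s : Finset ℝˣ, ∀ a, ℓ (toLaurent (∏ u ∈ s, (X - C (u : ℝ))) * a) = 0 := by
  induction n using Nat.strong_induction_on with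
  | _ n ih =>
  intro ℓ hpos F hF hn hann
  by_cases hdeg : F.degree = 0
  · obtain ⟨c, hc, rfl⟩ : ∃ c : ℝ, c ≠ 0 ∧ F = C c := by
      refine ⟨F.coeff 0, ?_, eq_C_of_degree_eq_zero hdeg⟩
      intro h
      rw [eq_C_of_degree_eq_zero hdeg, h, map_zero] at hF
      exact hF rfl
    refine ⟨∅, fun a => ?_⟩
    have := hann (c⁻¹ • a)
    rw [toLaurent_C, ← LaurentPolynomial.smul_eq_C_mul, smul_smul, mul_inv_cancel₀ hc,
      one_smul] at this
    simpa using this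
  obtain ⟨z, hz⟩ := IsAlgClosed.exists_aeval_eq_zero ℂ F hdeg
  by_cases him : z.im = 0
  · have hroot : F.IsRoot z.re := by
      have hz' : z = algebraMap ℝ ℂ z.re := by
        apply Complex.ext <;> simp [him]
      rw [hz', aeval_algebraMap_apply] at hz
      simpa using hz
    obtain ⟨K, rfl⟩ := dvd_iff_isRoot.2 hroot
    have hK : K ≠ 0 := right_ne_zero_of_mul hF
    have hKn : K.natDegree < n := by
      rw [← hn, natDegree_mul (X_sub_C_ne_zero _) hK, natDegree_X_sub_C]
      omega
    -- The variable `t` is a unit, so a root at `0` can be divided out without changing the ideal.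
    by_cases hr : z.re = 0
    · refine ih _ hKn ℓ hpos K hK rfl fun a => ?_
      have := hann (LaurentPolynomial.T (-1) * a)
      rw [hr, map_zero, sub_zero, map_mul toLaurent, toLaurent_X] at this
      rw [← this]
      congr 1
      have h1 : (LaurentPolynomial.T 1 * LaurentPolynomial.T (-1) : ℝ[T;T⁻¹]) = 1 := by
        rw [← LaurentPolynomial.T_add]; simp
      calc toLaurent K * a = LaurentPolynomial.T 1 * LaurentPolynomial.T (-1) *
            (toLaurent K * a) := by rw [h1, one_mul]
        _ = _ := by ring
    · set u : ℝˣ := Units.mk0 z.re hr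
      set x : ℝ[T;T⁻¹] := toLaurent (X - C (u : ℝ)) with hx
      -- The functional `ℓ(x² ·)` is again nonnegative and annihilates the smaller factor `K`.
      obtain ⟨s, hs⟩ := ih _ hKn (ℓ ∘ₗ LinearMap.mulLeft ℝ (x * x)) (fun a => by
        have := hpos (x * a)
        rw [show x * a * (x * a) = x * x * (a * a) by ring] at this
        exact this) K hK rfl (fun a => by
        have := hann (x * a)
        rw [map_mul toLaurent] at this
        rw [← this]
        change ℓ (x * x * (toLaurent K * a)) = _
        congr 1
        rw [show toLaurent (X - C z.re) = x from rfl]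
        ring)
      classical
      refine ⟨insert u s, ?_⟩
      set N := ∏ v ∈ insert u s, (X - C (v : ℝ)) with hN
      obtain ⟨M, hM⟩ : ∏ v ∈ s, (X - C (v : ℝ)) ∣ N :=
        Finset.prod_dvd_prod_of_subset _ _ _ (Finset.subset_insert _ _)
      obtain ⟨P, hP⟩ : X - C (u : ℝ) ∣ N :=
        Finset.dvd_prod_of_mem (fun v : ℝˣ => X - C (v : ℝ)) (Finset.mem_insert_self u s)
      set y := toLaurent N with hy
      -- The product `y` over `insert u s` is divisible by `x` and by the product over `s`, so `y⁴`
      -- is `x²` times a multiple of the latter. Two applications of the degenerate Cauchy–Schwarz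
      -- lemma then descend from `y⁴` to `y²` to `y`; this works whether or not `u` is already in
      -- `s`.
      have h4 : ℓ (y * y * (y * y)) = 0 := by
        have := hs (toLaurent M * (toLaurent P * toLaurent P) * y)
        rw [← this]
        change _ = ℓ (x * x * (_))
        congr 1
        have e1 : y = toLaurent (∏ v ∈ s, (X - C (v : ℝ))) * toLaurent M := by
          rw [hy, hM, map_mul]
        have e2 : y = x * toLaurent P := by rw [hy, hP, map_mul]
        calc y * y * (y * y) = (x * toLaurent P) * (x * toLaurent P) *
              ((toLaurent (∏ v ∈ s, (X - C (v : ℝ))) * toLaurent M) * y) := by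
              rw [← e1, ← e2]
          _ = _ := by ring
      have h2 := apply_mul_eq_zero_of_apply_sq_eq_zero hpos h4 1
      rw [mul_one] at h2
      exact apply_mul_eq_zero_of_apply_sq_eq_zero hpos h2
  · obtain ⟨K, hK⟩ := F.quadratic_dvd_of_aeval_eq_zero_im_ne_zero hz him
    have hK0 : K ≠ 0 := by
      rintro rfl
      exact hF (by rw [hK, mul_zero])
    have hQ : (X ^ 2 - C (2 * z.re) * X + C (‖z‖ ^ 2) : ℝ[X]) =
        (X - C z.re) * (X - C z.re) + C (z.im * z.im) := by
      rw [Complex.sq_norm, Complex.normSq_apply]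
      simp only [map_add, map_mul, map_ofNat]
      ring
    have hQd : (X ^ 2 - C (2 * z.re) * X + C (‖z‖ ^ 2) : ℝ[X]).natDegree = 2 := by
      compute_degree!
    have hQ0 : (X ^ 2 - C (2 * z.re) * X + C (‖z‖ ^ 2) : ℝ[X]) ≠ 0 := by
      intro h; rw [h] at hQd; simp at hQd
    have hKn : K.natDegree < n := by
      rw [← hn, hK, natDegree_mul hQ0 hK0, hQd]
      omega
    -- For a nonreal root, `FK = ((X - re z)K)² + (im z)² K²`. Both terms have nonnegative value and
    -- the sum is zero, so `ℓ(K²) = 0` and `K` itself is annihilated.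
    refine ih _ hKn ℓ hpos K hK0 rfl ?_
    apply apply_mul_eq_zero_of_apply_sq_eq_zero hpos
    have h1 := hann (toLaurent K)
    have h2 : toLaurent F * toLaurent K =
        (toLaurent (X - C z.re) * toLaurent K) * (toLaurent (X - C z.re) * toLaurent K) +
        (z.im * z.im) • (toLaurent K * toLaurent K) := by
      rw [hK, hQ, map_mul, map_add, map_mul, toLaurent_C, LaurentPolynomial.smul_eq_C_mul]
      ring
    rw [h2, map_add, map_smul, smul_eq_mul] at h1
    have h3 := hpos (toLaurent (X - C z.re) * toLaurent K)
    have h4 := hpos (toLaurent K)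
    have h5 : 0 < z.im * z.im := mul_self_pos.2 him
    nlinarith

open Polynomial in
theorem exists_eq_nodal_mul {s : Finset ℝˣ} {a : ℝ[T;T⁻¹]}
    (ha : ∀ u ∈ s, LaurentPolynomial.eval₂ (RingHom.id ℝ) u a = 0) :
    ∃ b, a = toLaurent (∏ u ∈ s, (X - C (u : ℝ))) * b := by
  obtain ⟨n, p, hp⟩ := a.exists_T_pow
  obtain ⟨q, hq⟩ : ∏ u ∈ s, (X - C (u : ℝ)) ∣ p := by
    apply Finset.prod_dvd_of_coprime
    · exact (pairwise_coprime_X_sub_C Units.val_injective).set_pairwise _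
    · intro u hu
      rw [dvd_iff_isRoot]
      have h := congrArg (LaurentPolynomial.eval₂ (RingHom.id ℝ) u) hp
      rw [map_mul, ha u hu, zero_mul, LaurentPolynomial.eval₂_toLaurent, Polynomial.eval₂_id] at h
      exact h
  refine ⟨toLaurent q * LaurentPolynomial.T (-(n : ℤ)), ?_⟩
  rw [← mul_assoc, ← map_mul, ← hq, hp, mul_assoc, ← LaurentPolynomial.T_add]
  simp

open Polynomial in
/-- A nonnegative functional on Laurent polynomials annihilating a nonzero ideal is a finite
nonnegative combination of point evaluations. -/
theorem exists_atomic_representation {ℓ : ℝ[T;T⁻¹] →ₗ[ℝ] ℝ} (hpos : ∀ a, 0 ≤ ℓ (a * a))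
    {f : ℝ[T;T⁻¹]} (hf : f ≠ 0) (hann : ∀ a, ℓ (f * a) = 0) :
    ∃ (s : Finset ℝˣ) (w : ℝˣ → ℝ), (∀ u ∈ s, 0 ≤ w u) ∧
      ∀ a, ℓ a = ∑ u ∈ s, w u * LaurentPolynomial.eval₂ (RingHom.id ℝ) u a := by
  obtain ⟨n, F, hF⟩ := f.exists_T_pow
  have hF0 : F ≠ 0 := by
    rintro rfl
    rw [map_zero] at hF
    exact hf (((LaurentPolynomial.isUnit_T (R := ℝ) (n : ℤ)).mul_left_eq_zero).1 hF.symm)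
  obtain ⟨s, hs⟩ := exists_nodal_annihilated _ ℓ hpos F hF0 rfl fun a => by
    rw [hF, mul_assoc, hann]
  classical
  set e : ℝˣ → ℝ[T;T⁻¹] := fun u => toLaurent (Lagrange.basis s (fun v : ℝˣ => (v : ℝ)) u) with he
  have hev : ∀ u ∈ s, ∀ v ∈ s,
      LaurentPolynomial.eval₂ (RingHom.id ℝ) v (e u) = if u = v then 1 else 0 := by
    intro u hu v hv
    rw [he, LaurentPolynomial.eval₂_toLaurent, eval₂_id]
    split_ifs with h
    · subst h
      exact Lagrange.eval_basis_self (v := fun v : ℝˣ => (v : ℝ)) Units.val_injective.injOn hu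
    · exact Lagrange.eval_basis_of_ne (v := fun v : ℝˣ => (v : ℝ)) h hv
  have hzero : ∀ a : ℝ[T;T⁻¹],
      (∀ u ∈ s, LaurentPolynomial.eval₂ (RingHom.id ℝ) u a = 0) → ℓ a = 0 := by
    intro a ha
    obtain ⟨b, rfl⟩ := exists_eq_nodal_mul ha
    exact hs b
  refine ⟨s, fun u => ℓ (e u), fun u hu => ?_, fun a => ?_⟩
  -- The Lagrange polynomials are idempotent at the nodes, so each weight `ℓ(e_u)` equals `ℓ(e_u²)`.
  · have : ℓ (e u * e u - e u) = 0 := by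
      apply hzero
      intro v hv
      rw [map_sub, map_mul, hev u hu v hv]
      split_ifs <;> simp
    rw [map_sub, sub_eq_zero] at this
    exact (hpos (e u)).trans_eq this
  · have : ℓ (a - ∑ u ∈ s, LaurentPolynomial.C
        (LaurentPolynomial.eval₂ (RingHom.id ℝ) u a) * e u) = 0 := by
      apply hzero
      intro v hv
      rw [map_sub, map_sum, Finset.sum_eq_single v]
      · rw [map_mul, hev v hv v hv, LaurentPolynomial.eval₂_C]
        simp
      · intro u hu huv
        rw [map_mul, hev u hu v hv, if_neg huv, mul_zero]
      · exact fun h => absurd hv h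
    rw [map_sub, sub_eq_zero] at this
    rw [this, map_sum]
    refine Finset.sum_congr rfl fun u _ => ?_
    rw [← LaurentPolynomial.smul_eq_C_mul, map_smul, smul_eq_mul, mul_comm]

/-! ### The truncated problem for Laurent polynomials -/

/-- A functional on a subspace `E` which vanishes on `E ∩ (f)` agrees on `E` with a functional
annihilating `(f)`. -/
theorem exists_functional_annihilating (ℓ : ℝ[T;T⁻¹] →ₗ[ℝ] ℝ) (E : Submodule ℝ ℝ[T;T⁻¹])
    (f : ℝ[T;T⁻¹]) (h : ∀ m, f * m ∈ E → ℓ (f * m) = 0) :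
    ∃ ℓ' : ℝ[T;T⁻¹] →ₗ[ℝ] ℝ, (∀ m, ℓ' (f * m) = 0) ∧ ∀ g ∈ E, ℓ' g = ℓ g := by
  set I : Submodule ℝ ℝ[T;T⁻¹] := LinearMap.range (LinearMap.mulLeft ℝ f)
  set φ : E →ₗ[ℝ] (ℝ[T;T⁻¹] ⧸ I) := I.mkQ ∘ₗ E.subtype with hφ
  have hker : LinearMap.ker φ ≤ LinearMap.ker (ℓ ∘ₗ E.subtype) := by
    rintro ⟨x, hx⟩ hxk
    have : x ∈ I := by simpa [hφ] using hxk
    obtain ⟨m, rfl⟩ := this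
    exact h m hx
  obtain ⟨ψ, hψ⟩ := LinearMap.exists_extend
    (((LinearMap.ker φ).liftQ (ℓ ∘ₗ E.subtype) hker) ∘ₗ φ.quotKerEquivRange.symm.toLinearMap)
  refine ⟨ψ ∘ₗ I.mkQ, fun m => ?_, fun g hg => ?_⟩
  · have : I.mkQ (f * m) = 0 := by
      rw [Submodule.mkQ_apply, Submodule.Quotient.mk_eq_zero]
      exact ⟨m, rfl⟩
    rw [LinearMap.comp_apply, this, map_zero]
  · have h1 := LinearMap.congr_fun hψ (φ.rangeRestrict ⟨g, hg⟩)
    have h2 : φ.quotKerEquivRange.symm (φ.rangeRestrict ⟨g, hg⟩) =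
        (LinearMap.ker φ).mkQ ⟨g, hg⟩ := by
      rw [LinearEquiv.symm_apply_eq]
      rfl
    rw [LinearMap.comp_apply, LinearMap.comp_apply, LinearEquiv.coe_coe, h2] at h1
    exact h1

/-- The singular truncated moment problem on the punctured line. -/
theorem exists_atomic_on_twisted {a b : ℤ} {s : ℝ} (hs : s ≠ 0)
    (ℓ : ℝ[T;T⁻¹] →ₗ[ℝ] ℝ) {f : ℝ[T;T⁻¹]} (hf : f ∈ twisted a b s) (hb : f.coeff b ≠ 0)
    (hker : ∀ g ∈ twisted a b s, ℓ (f * g) = 0)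
    (hpos : ∀ g ∈ twisted a b (-s), 0 ≤ ℓ (g * g)) :
    ∃ (t : Finset ℝˣ) (w : ℝˣ → ℝ), (∀ u ∈ t, 0 ≤ w u) ∧
      ∀ g ∈ twisted (a + a) (b + b) (s * s),
        ℓ g = ∑ u ∈ t, w u * LaurentPolynomial.eval₂ (RingHom.id ℝ) u g := by
  obtain ⟨ℓ', h0, hE⟩ := exists_functional_annihilating ℓ (twisted (a + a) (b + b) (s * s)) f
    fun m hm => hker m (cofactor_mem_twisted hs hf hb hm)
  have hf0 : f ≠ 0 := by rintro rfl; simp at hb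
  obtain ⟨t, w, hw, hr⟩ := exists_atomic_representation (ℓ := ℓ') (fun x => by
    obtain ⟨r, hr, m, rfl⟩ := exists_twisted_add_mul hs hf hb x
    have e : (r + f * m) * (r + f * m) = r * r + f * (m * (r + r + f * m)) := by ring
    rw [e, map_add, h0, add_zero, hE _ (by simpa using mul_mem_twisted hr hr)]
    exact hpos r hr) hf0 h0
  exact ⟨t, w, hw, fun g hg => by rw [← hE g hg, hr]⟩

/-! ### Ranks of symmetric bilinear forms -/

/-- The rank of a symmetric form does not drop on `U` if and only if `U` and the kernel of the form
span the whole space. -/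
theorem rank_eq_rank_restrict_iff {E : Type*} [AddCommGroup E] [Module ℝ E]
    [FiniteDimensional ℝ E] (B : LinearMap.BilinForm ℝ E) (hB : ∀ x y, B x y = B y x)
    (U : Submodule ℝ E) :
    LinearMap.rank B = LinearMap.rank (LinearMap.BilinForm.restrict B U) ↔
      ∀ v, ∃ u ∈ U, ∀ w, B (v - u) w = 0 := by
  set ρ : (E →ₗ[ℝ] ℝ) →ₗ[ℝ] (U →ₗ[ℝ] ℝ) := LinearMap.lcomp ℝ ℝ U.subtype with hρ
  set D : U →ₗ[ℝ] (E →ₗ[ℝ] ℝ) := B ∘ₗ U.subtype with hD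
  have hres : LinearMap.BilinForm.restrict B U = ρ ∘ₗ D := rfl
  have hrank : LinearMap.rank B = LinearMap.rank (LinearMap.BilinForm.restrict B U) ↔
      Module.finrank ℝ (LinearMap.range B) = Module.finrank ℝ (LinearMap.range (ρ ∘ₗ D)) := by
    rw [hres, LinearMap.rank, LinearMap.rank, ← Module.finrank_eq_rank, ← Module.finrank_eq_rank,
      Nat.cast_inj]
  rw [hrank]
  constructor
  · intro h v
    have hle : LinearMap.range D ≤ LinearMap.range B := LinearMap.range_comp_le_range _ _
    have h1 : Module.finrank ℝ (LinearMap.range (ρ ∘ₗ D)) ≤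
        Module.finrank ℝ (LinearMap.range D) := by
      rw [LinearMap.range_comp]
      exact Submodule.finrank_map_le _ _
    -- The rank of the restriction is at most that of `B` on `U × E`, which is at most that of `B`.
    -- Equality at the ends forces the range of `D` to be all of the range of `B`.
    have heq := Submodule.eq_of_le_of_finrank_le hle (h ▸ h1)
    obtain ⟨u, hu⟩ : B v ∈ LinearMap.range D := heq ▸ LinearMap.mem_range_self B v
    refine ⟨u, u.2, fun w => ?_⟩
    rw [map_sub, ← hu]
    simp [hD]
  · intro h
    have h1 : LinearMap.range (ρ ∘ₗ D) = LinearMap.range (ρ ∘ₗ B) := by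
      apply le_antisymm
      · rintro _ ⟨u, rfl⟩
        exact ⟨u, rfl⟩
      · rintro _ ⟨v, rfl⟩
        obtain ⟨u, hu, huv⟩ := h v
        refine ⟨⟨u, hu⟩, ?_⟩
        have : B v = B u := by
          rw [← sub_eq_zero, ← map_sub]
          exact LinearMap.ext huv
        simp [hD, this]
    -- By symmetry, a vector orthogonal to `U` is orthogonal to `U` plus the kernel, hence to
    -- everything.
    have h2 : LinearMap.ker (ρ ∘ₗ B) = LinearMap.ker B := by
      apply le_antisymm
      · intro v hv
        rw [LinearMap.mem_ker] at hv ⊢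
        ext w
        obtain ⟨u, hu, huw⟩ := h w
        have e1 : B v u = 0 := LinearMap.congr_fun hv ⟨u, hu⟩
        have e2 := huw v
        rw [hB, map_sub, e1, sub_zero] at e2
        exact e2
      · intro v hv
        rw [LinearMap.mem_ker] at hv ⊢
        rw [LinearMap.comp_apply, hv, map_zero]
    rw [h1]
    have h3 := LinearMap.finrank_range_add_finrank_ker B
    have h4 := LinearMap.finrank_range_add_finrank_ker (ρ ∘ₗ B)
    rw [h2] at h4
    omega

/-! ### The parametrization of the curve -/

/-- If `c_0 = 0`, then `x` splits off; neither `x` nor the cofactor `y - q(x)` is a unit, since each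
has a zero. -/
theorem coeff_zero_ne_zero {c : Polynomial ℝ} (hirr : Irreducible (curvePoly c)) :
    c.coeff 0 ≠ 0 := by
  intro h
  obtain ⟨q, rfl⟩ := Polynomial.X_dvd_iff.2 h
  have e : curvePoly (Polynomial.X * q) = MvPolynomial.X 0 *
      (MvPolynomial.X 1 - Polynomial.aeval (MvPolynomial.X 0) q) := by
    rw [curvePoly, map_mul, Polynomial.aeval_X, mul_sub]
  rcases hirr.isUnit_or_isUnit e with h | h
  · simpa using (h.map (MvPolynomial.eval (0 : Fin 2 → ℝ))).ne_zero
  · refine (h.map (MvPolynomial.eval ![0, q.eval 0])).ne_zero ?_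
    rw [map_sub, ← MvPolynomial.coe_aeval_eq_eval, RingHom.coe_coe,
      ← Polynomial.aeval_algHom_apply]
    simp [Polynomial.aeval_def, Polynomial.coeff_zero_eq_eval_zero]

theorem coeff_toLaurent (p : Polynomial ℝ) (n : ℤ) :
    (Polynomial.toLaurent p).coeff n = if 0 ≤ n then p.coeff n.toNat else 0 := by
  induction p using Polynomial.induction_on' with
  | add p q hp hq => rw [map_add]; simp only [AddMonoidAlgebra.coeff_add, Finsupp.add_apply, hp, hq,
      Polynomial.coeff_add]; split_ifs <;> simp
  | monomial m r =>
    rw [Polynomial.toLaurent_C_mul_T, ← LaurentPolynomial.smul_eq_C_mul]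
    simp only [AddMonoidAlgebra.coeff_smul, Finsupp.smul_apply, LaurentPolynomial.T_apply,
      Polynomial.coeff_monomial, smul_eq_mul]
    split_ifs <;> first | omega | simp

theorem cDivT_spec {c : Polynomial ℝ} (hc : c.Monic) (hd : c.natDegree = 3) :
    cDivT c ∈ band (-1) 2 ∧ (cDivT c).coeff (-1) = c.coeff 0 ∧ (cDivT c).coeff 2 = 1 := by
  have e : ∀ n, (cDivT c).coeff n = if 0 ≤ n + 1 then c.coeff (n + 1).toNat else 0 := by
    intro n
    rw [cDivT, mul_comm, coeff_T_mul, coeff_toLaurent, sub_neg_eq_add]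
  refine ⟨fun n hn => ?_, ?_, ?_⟩
  · rw [e]
    split_ifs with h
    · exact Polynomial.coeff_eq_zero_of_natDegree_lt (by omega)
    · rfl
  · rw [e]; simp
  · rw [e]
    have : c.coeff 3 = 1 := hd ▸ hc
    simpa using this

theorem cDivT_pow_spec {c : Polynomial ℝ} (hc : c.Monic) (hd : c.natDegree = 3) (j : ℕ) :
    cDivT c ^ j ∈ band (-j) (2 * j) ∧ (cDivT c ^ j).coeff (-j) = c.coeff 0 ^ j ∧
      (cDivT c ^ j).coeff (2 * j) = 1 := by
  obtain ⟨h1, h2, h3⟩ := cDivT_spec hc hd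
  obtain ⟨h4, h5, h6⟩ := pow_band h1 j
  rw [mul_neg_one] at h4 h5
  rw [mul_comm (j : ℤ) 2] at h4 h6
  exact ⟨h4, by rw [h5, h2], by rw [h6, h3, one_pow]⟩

theorem dDivT_eq (c : Polynomial ℝ) (k : ℕ) :
    dDivT c k = cDivT c ^ k - (2 : ℝ) • LaurentPolynomial.T (2 * k : ℤ) := by
  have h2 : Polynomial.toLaurent (2 : Polynomial ℝ) = (2 : ℝ[T;T⁻¹]) := map_ofNat _ 2
  rw [dDivT, cDivT, map_sub, map_mul, map_pow, h2, Polynomial.toLaurent_X_pow, mul_pow,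
    LaurentPolynomial.T_pow, sub_mul, LaurentPolynomial.smul_eq_C_mul, map_ofNat, mul_neg_one,
    mul_assoc 2, ← LaurentPolynomial.T_add]
  congr 4
  push_cast
  ring

theorem band_le_twisted {a b a' b' : ℤ} (ha : a < a') (hb : b' < b) (s : ℝ) :
    band a' b' ≤ twisted a b s :=
  fun _ hf => ⟨band_mono ha.le hb.le hf, by rw [hf a (by omega), hf b (by omega), mul_zero]⟩

/-- Subtracting the multiple of `w` that removes the top coefficient removes the bottom one too,
because both elements have the same factor `s`. -/
theorem twisted_eq_sup {a b : ℤ} {s : ℝ} {w : ℝ[T;T⁻¹]} (hw : w ∈ twisted a b s)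
    (hb : w.coeff b ≠ 0) :
    twisted a b s = band (a + 1) (b - 1) ⊔ Submodule.span ℝ {w} := by
  apply le_antisymm
  · intro f hf
    rw [Submodule.mem_sup]
    refine ⟨f - (f.coeff b / w.coeff b) • w, ?_, (f.coeff b / w.coeff b) • w,
      Submodule.smul_mem _ _ (Submodule.mem_span_singleton_self w), by abel⟩
    intro n hn
    by_cases hna : n = a
    · subst hna
      simp [hf.2, hw.2]
      field_simp
      simp
    by_cases hnb : n = b
    · subst hnb
      simp [hb]
    simp [hf.1 n (by omega), hw.1 n (by omega)]
  · refine sup_le (band_le_twisted (by omega) (by omega) s) ?_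
    rw [Submodule.span_singleton_le_iff_mem]
    exact hw

theorem cDivT_pow_mem_twisted {c : Polynomial ℝ} (hc : c.Monic) (hd : c.natDegree = 3) (k : ℕ) :
    cDivT c ^ k ∈ twisted (-k) (2 * k) (c.coeff 0 ^ k) := by
  obtain ⟨h1, h2, h3⟩ := cDivT_pow_spec hc hd k
  exact ⟨h1, by rw [h2, h3, mul_one]⟩

theorem coeff_dDivT {c : Polynomial ℝ} (hc : c.Monic) (hd : c.natDegree = 3) (k : ℕ) :
    (dDivT c k).coeff (2 * k) = -1 := by
  obtain ⟨h1, h2, h3⟩ := cDivT_pow_spec hc hd k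
  simp [dDivT_eq, h3]
  norm_num

theorem dDivT_mem_twisted {c : Polynomial ℝ} (hc : c.Monic) (hd : c.natDegree = 3) {k : ℕ}
    (hk : 1 ≤ k) : dDivT c k ∈ twisted (-k) (2 * k) (-c.coeff 0 ^ k) := by
  obtain ⟨h1, h2, h3⟩ := cDivT_pow_spec hc hd k
  refine ⟨?_, ?_⟩
  · rw [dDivT_eq]
    exact sub_mem h1 (Submodule.smul_mem _ _ (T_mem_band (by omega) le_rfl))
  · rw [coeff_dDivT hc hd, dDivT_eq]
    simp only [AddMonoidAlgebra.coeff_sub, AddMonoidAlgebra.coeff_smul, Finsupp.coe_sub,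
      Finsupp.coe_smul, Pi.sub_apply, Pi.smul_apply, smul_eq_mul, h2, LaurentPolynomial.T_apply]
    rw [if_neg (by omega)]
    ring

/-! ### Images of `ℝ[C]_{≤ k}`, `V^{(k)}`, `U` and `W` under `Φ` -/

/-- The elements `c/t, …, (c/t)^{k-1}, 1, t, …, t^{2k-1}`. -/
def innerSet (c : Polynomial ℝ) (k : ℕ) : Set ℝ[T;T⁻¹] :=
  {f | ∃ j : ℕ, 1 ≤ j ∧ j < k ∧ f = cDivT c ^ j} ∪
    {f | ∃ j : ℕ, j < 2 * k ∧ f = LaurentPolynomial.T (j : ℤ)}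

theorem innerSet_subset_band {c : Polynomial ℝ} (hc : c.Monic) (hd : c.natDegree = 3) (k : ℕ) :
    innerSet c k ⊆ band (-k + 1) (2 * k - 1) := by
  rintro f (⟨j, h1, h2, rfl⟩ | ⟨j, h1, rfl⟩)
  · exact band_mono (by omega) (by omega) (cDivT_pow_spec hc hd j).1
  · exact T_mem_band (by omega) (by omega)

/-- Triangular elimination: powers of `c/t`, with bottom coefficients `c_0^j ≠ 0`, clear the
negative exponents from below, then monomials in `t` clear the rest from above. -/
theorem span_innerSet {c : Polynomial ℝ} (hc : c.Monic) (hd : c.natDegree = 3)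
    (h0 : c.coeff 0 ≠ 0) {k : ℕ} (hk : 1 ≤ k) :
    Submodule.span ℝ (innerSet c k) = band (-k + 1) (2 * k - 1) := by
  apply le_antisymm (Submodule.span_le.2 (innerSet_subset_band hc hd k))
  have hnonneg : ∀ m : ℕ, m ≤ 2 * k → band 0 (m - 1) ≤ Submodule.span ℝ (innerSet c k) := by
    intro m
    induction m with
    | zero =>
      intro _ f hf
      have : f = 0 := by
        ext n
        rw [hf n (by omega)]
        simp
      rw [this]
      exact zero_mem _
    | succ m ih =>
      intro hm f hf
      rw [show ((m + 1 : ℕ) : ℤ) - 1 = m by push_cast; ring] at hf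
      have h := ih (by omega) (sub_smul_mem_band_right hf
        (T_mem_band (by omega) le_rfl : LaurentPolynomial.T (m : ℤ) ∈ band 0 m) (by simp))
      have hT : (LaurentPolynomial.T (m : ℤ) : ℝ[T;T⁻¹]) ∈ Submodule.span ℝ (innerSet c k) :=
        Submodule.subset_span (Or.inr ⟨m, by omega, rfl⟩)
      have := add_mem h (Submodule.smul_mem _ (f.coeff (m : ℤ) /
        (LaurentPolynomial.T (m : ℤ) : ℝ[T;T⁻¹]).coeff (m : ℤ)) hT)
      rwa [sub_add_cancel] at this
  have hneg : ∀ m : ℕ, m < k → band (-m) (2 * k - 1) ≤ Submodule.span ℝ (innerSet c k) := by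
    intro m
    induction m with
    | zero => intro _; simpa using hnonneg (2 * k) le_rfl
    | succ m ih =>
      intro hm f hf
      obtain ⟨h1, h2, h3⟩ := cDivT_pow_spec hc hd (m + 1)
      have h := sub_smul_mem_band_left hf (band_mono le_rfl (by push_cast; omega) h1)
        (by rw [h2]; exact pow_ne_zero _ h0)
      have h := ih (by omega) (band_mono (by push_cast; omega) le_rfl h)
      have hT : cDivT c ^ (m + 1) ∈ Submodule.span ℝ (innerSet c k) :=
        Submodule.subset_span (Or.inl ⟨m + 1, by omega, hm, rfl⟩)
      have := add_mem h (Submodule.smul_mem _ (f.coeff (-(m + 1 : ℕ) : ℤ) /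
        (cDivT c ^ (m + 1)).coeff (-(m + 1 : ℕ) : ℤ)) hT)
      rwa [sub_add_cancel] at this
  have := hneg (k - 1) (by omega)
  rwa [show (-((k - 1 : ℕ) : ℤ)) = -k + 1 by omega] at this

theorem Phi_resMap (c : Polynomial ℝ) (p : MvPolynomial (Fin 2) ℝ) :
    Phi c (resMap (curve c) p) = preParam c p := rfl

theorem Phi_xC (c : Polynomial ℝ) : Phi c (xC c) = LaurentPolynomial.T 1 := by
  rw [xC, Phi_resMap, preParam]; simp

theorem Phi_yC (c : Polynomial ℝ) : Phi c (yC c) = cDivT c := by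
  rw [yC, Phi_resMap, preParam]; simp

theorem Phi_xC_pow (c : Polynomial ℝ) (j : ℕ) : Phi c (xC c ^ j) = LaurentPolynomial.T (j : ℤ) := by
  rw [map_pow, Phi_xC, LaurentPolynomial.T_pow, mul_one]

theorem Phi_yC_pow (c : Polynomial ℝ) (j : ℕ) : Phi c (yC c ^ j) = cDivT c ^ j := by
  rw [map_pow, Phi_yC]

theorem mem_curve_iff {c : Polynomial ℝ} {z : Fin 2 → ℝ} :
    z ∈ curve c ↔ z 0 * z 1 = c.eval (z 0) := by
  have h : MvPolynomial.eval z (Polynomial.aeval (MvPolynomial.X 0) c) = c.eval (z 0) := by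
    rw [← MvPolynomial.coe_aeval_eq_eval, RingHom.coe_coe, ← Polynomial.aeval_algHom_apply]
    simp [Polynomial.aeval_def, Polynomial.eval₂_id]
  simp only [curve, curvePoly, Set.mem_ofPred_eq, map_sub, map_mul, MvPolynomial.eval_X, h,
    sub_eq_zero]

theorem exists_param {c : Polynomial ℝ} (h0 : c.coeff 0 ≠ 0) {z : Fin 2 → ℝ} (hz : z ∈ curve c) :
    ∃ u : ℝˣ, z = ![(u : ℝ), c.eval (u : ℝ) * (u : ℝ)⁻¹] := by
  rw [mem_curve_iff] at hz
  have hz0 : z 0 ≠ 0 := by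
    intro h
    rw [h, zero_mul, ← Polynomial.coeff_zero_eq_eval_zero] at hz
    exact h0 hz.symm
  refine ⟨Units.mk0 (z 0) hz0, ?_⟩
  ext i
  fin_cases i
  · simp
  · simp only [Units.val_mk0, ← hz]
    simp
    field_simp

/-- A polynomial killed by `Φ` vanishes at every parametrized point, and `c_0 ≠ 0` excludes points
of the curve with `x = 0`, so the parametrization misses none. -/
theorem Phi_injective {c : Polynomial ℝ} (h0 : c.coeff 0 ≠ 0) : Function.Injective (Phi c) := by
  rw [injective_iff_map_eq_zero]
  intro f hf
  obtain ⟨p, rfl⟩ := Ideal.Quotient.mk_surjective f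
  rw [Ideal.Quotient.eq_zero_iff_mem, MvPolynomial.mem_vanishingIdeal_iff]
  intro z hz
  obtain ⟨u, rfl⟩ := exists_param h0 hz
  rw [MvPolynomial.aeval_eq_eval]
  have := eval_preParam c u p
  rw [← Phi_resMap] at this
  change LaurentPolynomial.eval₂ (RingHom.id ℝ) u (Phi c (Ideal.Quotient.mk _ p)) = _ at this
  rw [hf, map_zero] at this
  exact this.symm

theorem coordLE_eq_span (c : Polynomial ℝ) (k : ℕ) :
    CoordLE (curve c) k =
      Submodule.span ℝ {f | ∃ a b : ℕ, a + b ≤ k ∧ f = xC c ^ a * yC c ^ b} := by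
  apply le_antisymm
  · rintro _ ⟨p, hp, rfl⟩
    rw [SetLike.mem_coe, MvPolynomial.mem_restrictTotalDegree] at hp
    rw [p.as_sum, map_sum]
    refine Submodule.sum_mem _ fun v hv => ?_
    have hv' := (MvPolynomial.le_totalDegree hv).trans hp
    have e : (resMap (curve c)).toLinearMap (MvPolynomial.monomial v (p.coeff v)) =
        p.coeff v • (xC c ^ v 0 * yC c ^ v 1) := by
      rw [MvPolynomial.monomial_eq, ← MvPolynomial.smul_eq_C_mul, map_smul]
      congr 1
      rw [Finsupp.prod_fintype _ _ (by simp), Fin.prod_univ_two]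
      simp [xC, yC]
    rw [e]
    refine Submodule.smul_mem _ _ (Submodule.subset_span ⟨v 0, v 1, ?_, rfl⟩)
    rw [Finsupp.sum_fintype _ _ (by simp), Fin.sum_univ_two] at hv'
    exact hv'
  · rw [Submodule.span_le]
    rintro _ ⟨a, b, hab, rfl⟩
    exact monomial_mem_coordLE c hab

theorem monomial_mem_span_basisSet {c : Polynomial ℝ} (hc : c.Monic) (hd : c.natDegree = 3)
    (k : ℕ) (a : ℕ) :
    ∀ b : ℕ, a + b ≤ k → xC c ^ a * yC c ^ b ∈ Submodule.span ℝ (basisSet c k) := by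
  induction a using Nat.strong_induction_on with
  | _ a ih =>
  intro b hab
  by_cases ha : a ≤ 2
  · exact Submodule.subset_span ⟨a, b, ha, hab, rfl⟩
  obtain ⟨a, rfl⟩ : ∃ a', a = a' + 3 := ⟨a - 3, by omega⟩
  have h3 : xC c ^ 3 = xC c * yC c - c.coeff 2 • xC c ^ 2 - c.coeff 1 • xC c ^ 1
      - c.coeff 0 • xC c ^ 0 := by
    have h1 : c.coeff 3 = 1 := hd ▸ hc
    rw [xC_mul_yC, Polynomial.aeval_eq_sum_range, hd]
    simp only [Finset.sum_range_succ, Finset.sum_range_zero, h1, one_smul]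
    abel
  have h4 : xC c ^ (a + 3) * yC c ^ b = xC c ^ (a + 1) * yC c ^ (b + 1)
      - c.coeff 2 • (xC c ^ (a + 2) * yC c ^ b) - c.coeff 1 • (xC c ^ (a + 1) * yC c ^ b)
      - c.coeff 0 • (xC c ^ a * yC c ^ b) := by
    rw [pow_add _ a 3, h3]
    simp only [mul_sub, sub_mul, mul_smul_comm, smul_mul_assoc]
    congr 1
    · congr 1
      · congr 1
        · ring
        · congr 1; ring
      · congr 1; ring
    · congr 1; ring
  rw [h4]
  exact sub_mem (sub_mem (sub_mem (ih _ (by omega) _ (by omega))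
    (Submodule.smul_mem _ _ (ih _ (by omega) _ (by omega))))
    (Submodule.smul_mem _ _ (ih _ (by omega) _ (by omega))))
    (Submodule.smul_mem _ _ (ih _ (by omega) _ (by omega)))

theorem Phi_monomial_mem_band {c : Polynomial ℝ} (hc : c.Monic) (hd : c.natDegree = 3)
    {a b k : ℕ} (hab : a + b ≤ k) (hb : b < k) :
    Phi c (xC c ^ a * yC c ^ b) ∈ band (-k + 1) (2 * k - 1) := by
  rw [map_mul, Phi_xC_pow, Phi_yC_pow]
  exact band_mono (by omega) (by omega)
    (mul_mem_band (T_mem_band le_rfl le_rfl) (cDivT_pow_spec hc hd b).1)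

/-- A monomial `x^a y^b` has exponents in `[a - b, a + 2b]`, which is inside the inner band when `a
+ b ≤ k` and `b < k`. Only `y^k` reaches the ends, with coefficients `c_0^k` and `1`. -/
theorem map_Phi_coordLE {c : Polynomial ℝ} (hc : c.Monic) (hd : c.natDegree = 3)
    (h0 : c.coeff 0 ≠ 0) {k : ℕ} (hk : 1 ≤ k) :
    (CoordLE (curve c) k).map (Phi c).toLinearMap = twisted (-k) (2 * k) (c.coeff 0 ^ k) := by
  apply le_antisymm
  · rw [coordLE_eq_span, Submodule.map_span, Submodule.span_le]
    rintro _ ⟨_, ⟨a, b, hab, rfl⟩, rfl⟩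
    by_cases hb : b < k
    · exact band_le_twisted (by omega) (by omega) _ (Phi_monomial_mem_band hc hd hab hb)
    · obtain rfl : a = 0 := by omega
      obtain rfl : b = k := by omega
      rw [pow_zero, one_mul, AlgHom.toLinearMap_apply, Phi_yC_pow]
      exact cDivT_pow_mem_twisted hc hd b
  · rw [twisted_eq_sup (cDivT_pow_mem_twisted hc hd k)
      (by rw [(cDivT_pow_spec hc hd k).2.2]; exact one_ne_zero), ← span_innerSet hc hd h0 hk]
    refine sup_le (Submodule.span_le.2 ?_) ?_
    · rintro f (⟨j, h1, h2, rfl⟩ | ⟨j, h1, rfl⟩)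
      · exact ⟨yC c ^ j, by simpa using monomial_mem_coordLE c (a := 0) (b := j) (by omega),
          Phi_yC_pow c j⟩
      · exact ⟨xC c ^ j, xC_pow_mem c hc hd k j h1, Phi_xC_pow c j⟩
    · rw [Submodule.span_singleton_le_iff_mem]
      exact ⟨yC c ^ k, by simpa using monomial_mem_coordLE c (a := 0) (b := k) (by omega),
          Phi_yC_pow c k⟩

theorem Phi_yC_pow_sub (c : Polynomial ℝ) (k : ℕ) :
    Phi c (yC c ^ k - 2 * xC c ^ (2 * k)) = dDivT c k := by
  rw [dDivT_eq, map_sub, map_mul, map_ofNat, Phi_yC_pow, Phi_xC_pow,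
    LaurentPolynomial.smul_eq_C_mul, map_ofNat]
  push_cast
  rfl

/-- Expand `x^j` in the family `basisSet`: since `j < 2k`, comparing coefficients of `t^{2k}`, where
only `y^k` contributes, shows that `y^k` does not occur. -/
theorem xC_pow_mem_Vk {c : Polynomial ℝ} (hc : c.Monic) (hd : c.natDegree = 3) {k : ℕ}
    {j : ℕ} (hj : j < 2 * k) : xC c ^ j ∈ Vk c k := by
  have h1 : xC c ^ j ∈ Submodule.span ℝ (basisSet c k) := by
    have h := xC_pow_mem c hc hd k j hj
    rw [coordLE_eq_span] at h
    refine Submodule.span_le.2 ?_ h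
    rintro _ ⟨a, b, hab, rfl⟩
    exact monomial_mem_span_basisSet hc hd k a b hab
  have h2 : Submodule.span ℝ (basisSet c k) ≤
      Submodule.span ℝ (basisSet c k \ {yC c ^ k}) ⊔ Submodule.span ℝ {yC c ^ k} := by
    rw [← Submodule.span_union]
    apply Submodule.span_mono
    intro f hf
    by_cases h : f = yC c ^ k
    · exact Or.inr h
    · exact Or.inl ⟨hf, h⟩
  obtain ⟨m, hm, y, hy, he⟩ := Submodule.mem_sup.1 (h2 h1)
  obtain ⟨r, rfl⟩ := Submodule.mem_span_singleton.1 hy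
  have hmb : Phi c m ∈ band (-k + 1) (2 * k - 1) := by
    refine (Submodule.span_le (p := (band (-k + 1) (2 * k - 1)).comap (Phi c).toLinearMap)).2 ?_ hm
    rintro _ ⟨⟨a, b, ha, hab, rfl⟩, hne⟩
    refine Phi_monomial_mem_band hc hd hab ?_
    by_contra hb
    obtain rfl : a = 0 := by omega
    obtain rfl : b = k := by omega
    simp at hne
  have hr : r = 0 := by
    have h := congrArg (fun f => (Phi c f).coeff (2 * k : ℤ)) he
    simp only [map_add, map_smul, Phi_yC_pow, Phi_xC_pow, AddMonoidAlgebra.coeff_add,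
      AddMonoidAlgebra.coeff_smul, Finsupp.add_apply, Finsupp.smul_apply,
      (cDivT_pow_spec hc hd k).2.2, LaurentPolynomial.T_apply, smul_eq_mul, mul_one] at h
    rw [hmb _ (by omega), if_neg (by omega), zero_add] at h
    exact h
  rw [hr, zero_smul, add_zero] at he
  rw [← he]
  exact Submodule.span_mono Set.subset_union_left hm

theorem map_Phi_Vk {c : Polynomial ℝ} (hc : c.Monic) (hd : c.natDegree = 3)
    (h0 : c.coeff 0 ≠ 0) {k : ℕ} (hk : 1 ≤ k) :
    (Vk c k).map (Phi c).toLinearMap = twisted (-k) (2 * k) (-c.coeff 0 ^ k) := by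
  apply le_antisymm
  · rw [Vk, Submodule.map_span, Submodule.span_le]
    rintro _ ⟨_, ⟨⟨a, b, ha, hab, rfl⟩, hne⟩ | rfl, rfl⟩
    · refine band_le_twisted (by omega) (by omega) _ (Phi_monomial_mem_band hc hd hab ?_)
      by_contra hb
      obtain rfl : a = 0 := by omega
      obtain rfl : b = k := by omega
      simp at hne
    · rw [AlgHom.toLinearMap_apply, Phi_yC_pow_sub]
      exact dDivT_mem_twisted hc hd hk
  · rw [twisted_eq_sup (dDivT_mem_twisted hc hd hk)
      (by rw [coeff_dDivT hc hd k]; norm_num), ← span_innerSet hc hd h0 hk]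
    refine sup_le (Submodule.span_le.2 ?_) ?_
    · rintro f (⟨j, h1, h2, rfl⟩ | ⟨j, h1, rfl⟩)
      · refine ⟨yC c ^ j, Submodule.subset_span (Or.inl ⟨⟨0, j, by omega, by omega, by simp⟩, ?_⟩),
          Phi_yC_pow c j⟩
        intro h
        have h := congrArg (fun f => (Phi c f).coeff (2 * k : ℤ)) h
        simp only [Phi_yC_pow, (cDivT_pow_spec hc hd k).2.2] at h
        rw [(cDivT_pow_spec hc hd j).1 _ (by omega)] at h
        exact zero_ne_one h
      · exact ⟨xC c ^ j, xC_pow_mem_Vk hc hd h1, Phi_xC_pow c j⟩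
    · rw [Submodule.span_singleton_le_iff_mem]
      exact ⟨_, Submodule.subset_span (Or.inr rfl), Phi_yC_pow_sub c k⟩

theorem map_Phi_span_preimage {c : Polynomial ℝ} (hc : c.Monic) (hd : c.natDegree = 3)
    (h0 : c.coeff 0 ≠ 0) {k : ℕ} (hk : 1 ≤ k) {S : Set ℝ[T;T⁻¹]} (h1 : innerSet c k ⊆ S)
    (h2 : S ⊆ band (-k + 1) (2 * k - 1)) :
    (Submodule.span ℝ (Phi c ⁻¹' S)).map (Phi c).toLinearMap = band (-k + 1) (2 * k - 1) := by
  apply le_antisymm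
  · rw [Submodule.map_span, Submodule.span_le]
    rintro _ ⟨f, hf, rfl⟩
    exact h2 hf
  · rw [← span_innerSet hc hd h0 hk, Submodule.map_span]
    apply Submodule.span_mono
    intro f hf
    obtain ⟨g, rfl⟩ : ∃ g, Phi c g = f := by
      rcases hf with (⟨j, -, -, rfl⟩ | ⟨j, -, rfl⟩)
      · exact ⟨_, Phi_yC_pow c j⟩
      · exact ⟨_, Phi_xC_pow c j⟩
    exact ⟨g, h1 hf, rfl⟩

theorem map_Phi_Uk {c : Polynomial ℝ} (hc : c.Monic) (hd : c.natDegree = 3)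
    (h0 : c.coeff 0 ≠ 0) {k : ℕ} (hk : 1 ≤ k) :
    (Uk c k).map (Phi c).toLinearMap = band (-k + 1) (2 * k - 1) := by
  apply map_Phi_span_preimage hc hd h0 hk
  · intro f hf
    refine ⟨?_, ?_⟩
    · rcases hf with (⟨j, h1, h2, rfl⟩ | ⟨j, h1, rfl⟩)
      · exact Or.inl ⟨j, h1, h2.le, rfl⟩
      · exact Or.inr ⟨j, h1, rfl⟩
    · rintro rfl
      have h := innerSet_subset_band hc hd k hf (2 * k) (by omega)
      rw [(cDivT_pow_spec hc hd k).2.2] at h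
      exact one_ne_zero h
  · rintro f ⟨(⟨j, h1, h2, rfl⟩ | ⟨j, h1, rfl⟩), hne⟩
    · apply innerSet_subset_band hc hd k
      refine Or.inl ⟨j, h1, lt_of_le_of_ne h2 ?_, rfl⟩
      rintro rfl
      exact hne rfl
    · exact innerSet_subset_band hc hd k (Or.inr ⟨j, h1, rfl⟩)

theorem map_Phi_Wk {c : Polynomial ℝ} (hc : c.Monic) (hd : c.natDegree = 3)
    (h0 : c.coeff 0 ≠ 0) {k : ℕ} (hk : 1 ≤ k) :
    (Wk c k).map (Phi c).toLinearMap = band (-k + 1) (2 * k - 1) := by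
  apply map_Phi_span_preimage hc hd h0 hk
  · intro f hf
    refine ⟨?_, ?_⟩
    · rcases hf with hf | hf
      · exact Or.inl (Or.inr hf)
      · exact Or.inr hf
    · rintro rfl
      have h := innerSet_subset_band hc hd k hf (2 * k) (by omega)
      rw [coeff_dDivT hc hd k] at h
      norm_num at h
  · rintro f ⟨((rfl | hf) | hf), hne⟩
    · exact absurd rfl hne
    · exact innerSet_subset_band hc hd k (Or.inl hf)
    · exact innerSet_subset_band hc hd k (Or.inr hf)

/-- Every Laurent polynomial lies in the inner band of a large enough `n`, which is the image of `Uk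
c n`. -/
theorem Phi_surjective {c : Polynomial ℝ} (hc : c.Monic) (hd : c.natDegree = 3)
    (h0 : c.coeff 0 ≠ 0) : Function.Surjective (Phi c) := by
  intro g
  by_cases hg : g = 0
  · exact ⟨0, by rw [hg, map_zero]⟩
  obtain ⟨a, b, hab, -, -⟩ := exists_extreme_coeff hg
  set n : ℕ := a.natAbs + b.natAbs + 1 with hn
  have h : g ∈ (Uk c n).map (Phi c).toLinearMap := by
    rw [map_Phi_Uk hc hd h0 (by omega)]
    exact band_mono (by omega) (by omega) hab
  obtain ⟨f, -, hf⟩ := h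
  exact ⟨f, hf⟩

/-! ### Transport of functionals and the rank condition -/

/-- A functional on `ℝ[C]_{≤ n}` transported to Laurent polynomials. -/
theorem exists_laurent_functional {c : Polynomial ℝ} (h0 : c.coeff 0 ≠ 0) {n : ℕ}
    (ℓ : CoordLE (curve c) n →ₗ[ℝ] ℝ) :
    ∃ Λ : ℝ[T;T⁻¹] →ₗ[ℝ] ℝ, ∀ f (hf : f ∈ CoordLE (curve c) n), Λ (Phi c f) = ℓ ⟨f, hf⟩ := by
  obtain ⟨ψ, hψ⟩ := LinearMap.exists_leftInverse_of_injective (Phi c).toLinearMap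
    (LinearMap.ker_eq_bot.2 (Phi_injective h0))
  obtain ⟨ℓ', hℓ⟩ := LinearMap.exists_extend ℓ
  refine ⟨ℓ' ∘ₗ ψ, fun f hf => ?_⟩
  have h1 : ψ (Phi c f) = f := LinearMap.congr_fun hψ f
  rw [LinearMap.comp_apply, h1, ← hℓ]
  rfl

theorem localForm_one_apply {c : Polynomial ℝ} {n : ℕ} {ℓ : CoordLE (curve c) n →ₗ[ℝ] ℝ}
    {Λ : ℝ[T;T⁻¹] →ₗ[ℝ] ℝ}
    (hΛ : ∀ f (hf : f ∈ CoordLE (curve c) n), Λ (Phi c f) = ℓ ⟨f, hf⟩)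
    {V : Submodule ℝ (CoordRing (curve c))}
    (hV : ∀ g ∈ V, ∀ h ∈ V, 1 * (g * h) ∈ CoordLE (curve c) n) (g h : V) :
    localForm ℓ V 1 hV g h = Λ (Phi c g * Phi c h) := by
  rw [← map_mul, ← one_mul ((g : CoordRing (curve c)) * h)]
  exact (hΛ _ (hV g g.2 h h.2)).symm

/-- The rank condition says that the kernel of the form contains an element with nonzero leading
coefficient. -/
theorem rank_eq_rank_formRestrict_iff {c : Polynomial ℝ} (h0 : c.coeff 0 ≠ 0) {a b : ℤ} {s : ℝ}
    {V U : Submodule ℝ (CoordRing (curve c))} [FiniteDimensional ℝ V]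
    (hV : V.map (Phi c).toLinearMap = twisted a b s)
    (hU : U.map (Phi c).toLinearMap = band (a + 1) (b - 1))
    (B : LinearMap.BilinForm ℝ V) (Λ : ℝ[T;T⁻¹] →ₗ[ℝ] ℝ)
    (hB : ∀ g h : V, B g h = Λ (Phi c g * Phi c h))
    {w : ℝ[T;T⁻¹]} (hw : w ∈ twisted a b s) (hwb : w.coeff b ≠ 0) :
    formRank B = formRank (formRestrict B U) ↔
      ∃ f ∈ twisted a b s, f.coeff b ≠ 0 ∧ ∀ g ∈ twisted a b s, Λ (f * g) = 0 := by
  have hmemU : ∀ v, Phi c v ∈ band (a + 1) (b - 1) → v ∈ U := by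
    intro v hv
    rw [← hU] at hv
    obtain ⟨u, hu, huv⟩ := hv
    rwa [← Phi_injective h0 huv]
  rw [formRank, formRank, formRestrict,
    rank_eq_rank_restrict_iff B (fun x y => by rw [hB, hB, mul_comm])]
  constructor
  · intro h
    obtain ⟨v, hv, rfl⟩ := hV ▸ hw
    obtain ⟨u, hu, hker⟩ := h ⟨v, hv⟩
    have hub : Phi c u ∈ band (a + 1) (b - 1) := hU ▸ Submodule.mem_map_of_mem hu
    have hut : Phi c u ∈ twisted a b s := hV ▸ Submodule.mem_map_of_mem u.2
    refine ⟨Phi c v - Phi c u, sub_mem hw hut, ?_, ?_⟩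
    -- The element `u` of `U` has no top coefficient, so that of `w` survives in the kernel element
    -- `v - u`.
    · simp only [AddMonoidAlgebra.coeff_sub, Finsupp.coe_sub, Pi.sub_apply]
      rw [hub b (by omega), sub_zero]
      exact hwb
    · intro g hg
      obtain ⟨x, hx, rfl⟩ := hV ▸ hg
      have := hker ⟨x, hx⟩
      rw [hB] at this
      rw [← map_sub]
      exact this
  · rintro ⟨f, hf, hfb, hker⟩ v
    obtain ⟨x, hx, rfl⟩ := hV ▸ hf
    rw [AlgHom.toLinearMap_apply] at hf hfb hker
    have hvt : Phi c v ∈ twisted a b s := hV ▸ Submodule.mem_map_of_mem v.2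
    -- One multiple of the kernel element clears both extreme coefficients of `v`, by the common
    -- factor `s`, leaving an element of `U`.
    refine ⟨v - ((Phi c v).coeff b / (Phi c x).coeff b) • ⟨x, hx⟩, ?_, fun w => ?_⟩
    · apply hmemU
      simp only [Submodule.subtype_apply, map_sub, map_smul]
      intro n hn
      by_cases hna : n = a
      · subst hna
        simp [hf.2, hvt.2]
        field_simp
        simp
      by_cases hnb : n = b
      · subst hnb
        simp [hfb]
      simp [hf.1 n (by omega), hvt.1 n (by omega)]
    · have hwt : Phi c w ∈ twisted a b s := hV ▸ Submodule.mem_map_of_mem w.2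
      rw [sub_sub_cancel, hB]
      simp only [SetLike.val_smul, map_smul, smul_mul_assoc, hker _ hwt, smul_zero]

theorem finiteDimensional_coordLE (S : Set (Fin 2 → ℝ)) (k : ℕ) :
    FiniteDimensional ℝ (CoordLE S k) :=
  Module.Finite.of_surjective _ (resLE_surjective S k)

theorem finiteDimensional_Vk (c : Polynomial ℝ) (k : ℕ) : FiniteDimensional ℝ (Vk c k) := by
  have h := finiteDimensional_coordLE (curve c) (2 * k)
  refine Submodule.finiteDimensional_of_le (S₂ := CoordLE (curve c) (2 * k)) ?_
  rw [Vk, Submodule.span_le]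
  rintro _ (⟨⟨a, b, ha, hab, rfl⟩, -⟩ | rfl)
  · exact monomial_mem_coordLE c (by omega)
  · refine sub_mem (by simpa using monomial_mem_coordLE c (a := 0) (b := k) (by omega)) ?_
    rw [two_mul (xC c ^ (2 * k))]
    have : xC c ^ (2 * k) ∈ CoordLE (curve c) (2 * k) := by
      simpa using monomial_mem_coordLE c (a := 2 * k) (b := 0) (by omega)
    exact add_mem this this

/-! ### Moment functionals -/

-- An element of `ℝ[C]_{≤ m}` may arise from a polynomial `p` of degree above `m`, as for squares of
-- `y^k - 2x^{2k}`. It agrees on the curve, hence almost everywhere, with a representative of degree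
-- at most `m`.
open MeasureTheory in
theorem integrable_and_apply_eq_integral {S : Set (Fin 2 → ℝ)} {m : ℕ} {L : PolyLE m →ₗ[ℝ] ℝ}
    (hL : VanishesOnIdeal S L) {μ : Measure (Fin 2 → ℝ)} (hS : μ Sᶜ = 0)
    (hμ : ∀ p : PolyLE m,
      Integrable (fun z => MvPolynomial.eval z (p : MvPolynomial (Fin 2) ℝ)) μ ∧
      L p = ∫ z, MvPolynomial.eval z (p : MvPolynomial (Fin 2) ℝ) ∂μ)
    (p : MvPolynomial (Fin 2) ℝ) (hp : resMap S p ∈ CoordLE S m) :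
    Integrable (fun z => MvPolynomial.eval z p) μ ∧
      inducedFunctional L hL ⟨resMap S p, hp⟩ = ∫ z, MvPolynomial.eval z p ∂μ := by
  obtain ⟨q, hq, hqp⟩ := id hp
  have hmem : q - p ∈ vanIdeal S := Ideal.Quotient.eq.1 hqp
  have hae : (fun z => MvPolynomial.eval z q) =ᵐ[μ] fun z => MvPolynomial.eval z p := by
    have hS' : ∀ᵐ z ∂μ, z ∈ S := hS
    filter_upwards [hS'] with z hz
    have := MvPolynomial.mem_vanishingIdeal_iff.1 hmem z hz
    rwa [MvPolynomial.aeval_eq_eval, map_sub, sub_eq_zero] at this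
  obtain ⟨h1, h2⟩ := hμ ⟨q, hq⟩
  refine ⟨h1.congr hae, ?_⟩
  rw [← integral_congr_ae hae, ← h2, ← inducedFunctional_resLE L hL]
  congr 1
  exact Subtype.ext hqp.symm

theorem IsMomentFunctional.apply_sq_nonneg {S : Set (Fin 2 → ℝ)} {m : ℕ} {L : PolyLE m →ₗ[ℝ] ℝ}
    (hL : VanishesOnIdeal S L) (hM : IsMomentFunctional S L) (f : CoordRing S)
    (hf : f * f ∈ CoordLE S m) : 0 ≤ inducedFunctional L hL ⟨f * f, hf⟩ := by
  obtain ⟨μ, hS, hμ⟩ := hM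
  obtain ⟨p, rfl⟩ := Ideal.Quotient.mk_surjective f
  have h := (integrable_and_apply_eq_integral hL hS hμ (p * p) hf).2
  refine le_of_le_of_eq ?_ h.symm
  refine MeasureTheory.integral_nonneg fun z => ?_
  rw [map_mul]
  exact mul_self_nonneg _

open MeasureTheory in
theorem IsMomentFunctional.apply_mul_eq_zero {S : Set (Fin 2 → ℝ)} {m : ℕ} {L : PolyLE m →ₗ[ℝ] ℝ}
    (hL : VanishesOnIdeal S L) (hM : IsMomentFunctional S L) (f h : CoordRing S)
    (hf : f * f ∈ CoordLE S m) (hfh : f * h ∈ CoordLE S m)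
    (hz : inducedFunctional L hL ⟨f * f, hf⟩ = 0) :
    inducedFunctional L hL ⟨f * h, hfh⟩ = 0 := by
  obtain ⟨μ, hS, hμ⟩ := hM
  obtain ⟨p, rfl⟩ := Ideal.Quotient.mk_surjective f
  obtain ⟨q, rfl⟩ := Ideal.Quotient.mk_surjective h
  obtain ⟨h1, h2⟩ := integrable_and_apply_eq_integral hL hS hμ (p * p) hf
  have h3 := (integrable_and_apply_eq_integral hL hS hμ (p * q) hfh).2
  have h4 : ∫ z, MvPolynomial.eval z (p * p) ∂μ = 0 := h2.symm.trans hz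
  rw [integral_eq_zero_iff_of_nonneg (fun z => by
    simp only [map_mul, Pi.zero_apply]; exact mul_self_nonneg _) h1] at h4
  refine h3.trans (integral_eq_zero_of_ae ?_)
  filter_upwards [h4] with z hz
  simp only [map_mul, Pi.zero_apply, mul_self_eq_zero] at hz ⊢
  rw [hz, zero_mul]

open MeasureTheory in
theorem isMomentFunctional_of_atomic {c : Polynomial ℝ} {m : ℕ} {L : PolyLE m →ₗ[ℝ] ℝ}
    (t : Finset ℝˣ) (w : ℝˣ → ℝ) (hw : ∀ u ∈ t, 0 ≤ w u)
    (h : ∀ p : PolyLE m, L p = ∑ u ∈ t, w u *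
      LaurentPolynomial.eval₂ (RingHom.id ℝ) u (preParam c (p : MvPolynomial (Fin 2) ℝ))) :
    IsMomentFunctional (curve c) L := by
  set z : ℝˣ → Fin 2 → ℝ := fun u => ![(u : ℝ), c.eval (u : ℝ) * (u : ℝ)⁻¹] with hz
  have hint : ∀ (g : (Fin 2 → ℝ) → ℝ), ∀ u ∈ t,
      Integrable g (ENNReal.ofReal (w u) • Measure.dirac (z u)) := fun g u _ =>
    (integrable_dirac (by simp)).smul_measure ENNReal.ofReal_ne_top
  refine ⟨∑ u ∈ t, ENNReal.ofReal (w u) • Measure.dirac (z u), ?_, fun p => ⟨?_, ?_⟩⟩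
  · rw [Measure.finsetSum_apply]
    refine Finset.sum_eq_zero fun u _ => ?_
    rw [Measure.smul_apply, Measure.dirac_apply, Set.indicator_of_notMem, smul_zero]
    exact fun hu => hu (curve_param_mem c u)
  · rw [integrable_finsetSum_measure]
    exact hint _
  · rw [integral_finsetSum_measure (hint _), h]
    refine Finset.sum_congr rfl fun u hu => ?_
    rw [integral_smul_measure, integral_dirac, ENNReal.toReal_ofReal (hw u hu), smul_eq_mul,
      eval_preParam]

/-- Only `s²` enters, so products within either test space (`s = γ` or `s = -γ`) land in the image
of `ℝ[C]_{≤ 2k}`. -/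
theorem twisted_double (k : ℕ) {c : Polynomial ℝ} {s : ℝ} (hs : s * s = c.coeff 0 ^ (2 * k)) :
    twisted (-k + -k) (2 * k + 2 * k) (s * s) =
      twisted (-(2 * k : ℕ)) (2 * (2 * k : ℕ)) (c.coeff 0 ^ (2 * k)) := by
  rw [hs]
  congr 1 <;> push_cast <;> ring

/-- A singular functional has a nonzero isotropic element in one of the two spaces. -/
theorem exists_isotropic_of_not_isNonsingular {c : Polynomial ℝ} (hc : c.Monic)
    (hd : c.natDegree = 3) {k : ℕ} (hk : 1 ≤ k) {L : PolyLE (2 * k) →ₗ[ℝ] ℝ}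
    (hL : VanishesOnIdeal (curve c) L) (hsing : ¬ IsNonsingular hc hd hk L hL) :
    ∃ f, f ≠ 0 ∧ (f ∈ CoordLE (curve c) k ∨ f ∈ Vk c k) ∧
      ∀ hf : f * f ∈ CoordLE (curve c) (2 * k), inducedFunctional L hL ⟨f * f, hf⟩ = 0 := by
  rw [IsNonsingular, not_and_or] at hsing
  rcases hsing with h | h
  -- The ideal always lies in the kernel, so failure of equality means a kernel element that is
  -- nonzero on the curve.
  · have hle : idealLE (curve c) k ≤ formKer (polyForm L) := by
      intro p hp
      rw [formKer, LinearMap.mem_ker]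
      ext q
      refine hL ?_
      have hp' : (p : MvPolynomial (Fin 2) ℝ) ∈ vanIdeal (curve c) := hp
      exact Ideal.mul_mem_left _ _ hp'
    obtain ⟨p, hp, hpi⟩ : ∃ p ∈ formKer (polyForm L), p ∉ idealLE (curve c) k := by
      by_contra hcon
      push Not at hcon
      exact h (le_antisymm hcon hle)
    refine ⟨resLE (curve c) k p, ?_, Or.inl (resLE (curve c) k p).2, fun hf => ?_⟩
    · intro h0
      rw [← ker_resLE, LinearMap.mem_ker] at hpi
      exact hpi (Subtype.ext h0)
    · rw [formKer, LinearMap.mem_ker] at hp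
      have h1 : polyForm L p p = 0 := LinearMap.congr_fun hp p
      rw [← h1]
      change _ = L ⟨(p : MvPolynomial (Fin 2) ℝ) * p, _⟩
      rw [← inducedFunctional_resLE L hL]
      congr 1
  · obtain ⟨v, hv, hv0⟩ := (Submodule.ne_bot_iff _).1 h
    refine ⟨v, fun h0 => hv0 (Subtype.ext h0), Or.inr v.2, fun hf => ?_⟩
    rw [formKer, LinearMap.mem_ker] at hv
    have h1 : VkForm hc hd hk (inducedFunctional L hL) v v = 0 := LinearMap.congr_fun hv v
    rw [← h1]
    change _ = inducedFunctional L hL ⟨1 * ((v : CoordRing (curve c)) * v), _⟩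
    congr 2
    rw [one_mul]

end CubicTMP

end

/-! ### The equivalence -/

open CubicTMP in
theorem theorem5p2 (c : Polynomial ℝ) (hc : c.Monic) (hd : c.natDegree = 3)
    (hirr : Irreducible (CubicTMP.curvePoly c)) (k : ℕ) (hk : 1 ≤ k)
    (L : CubicTMP.PolyLE (2 * k) →ₗ[ℝ] ℝ)
    (hL : CubicTMP.VanishesOnIdeal (CubicTMP.curve c) L)
    (hsing : ¬ CubicTMP.IsNonsingular hc hd hk L hL) :
    CubicTMP.IsMomentFunctional (CubicTMP.curve c) L ↔
      CubicTMP.SquarePositive (CubicTMP.coordForm (CubicTMP.inducedFunctional L hL)) ∧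
      CubicTMP.SquarePositive (CubicTMP.VkForm hc hd hk (CubicTMP.inducedFunctional L hL)) ∧
      (CubicTMP.formRank (CubicTMP.coordForm (CubicTMP.inducedFunctional L hL)) =
          CubicTMP.formRank (CubicTMP.formRestrict
            (CubicTMP.coordForm (CubicTMP.inducedFunctional L hL)) (CubicTMP.Uk c k)) ∨
        CubicTMP.formRank (CubicTMP.VkForm hc hd hk (CubicTMP.inducedFunctional L hL)) =
          CubicTMP.formRank (CubicTMP.formRestrict
            (CubicTMP.VkForm hc hd hk (CubicTMP.inducedFunctional L hL)) (CubicTMP.Wk c k))) := by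
  have h0 := coeff_zero_ne_zero hirr
  set γ : ℝ := c.coeff 0 ^ k with hγdef
  have hγ : γ ≠ 0 := pow_ne_zero _ h0
  have hγγ : γ * γ = c.coeff 0 ^ (2 * k) := by rw [hγdef]; ring
  obtain ⟨Λ, hΛ⟩ := exists_laurent_functional h0 (inducedFunctional L hL)
  have hQ := map_Phi_coordLE hc hd h0 hk
  have hR := map_Phi_Vk hc hd h0 hk
  have hT := map_Phi_coordLE hc hd h0 (k := 2 * k) (by omega)
  have hBQ : ∀ g h, coordForm (inducedFunctional L hL) g h = Λ (Phi c g * Phi c h) :=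
    localForm_one_apply hΛ one_mul_mul_mem_coordLE
  have hBR : ∀ g h, VkForm hc hd hk (inducedFunctional L hL) g h = Λ (Phi c g * Phi c h) :=
    localForm_one_apply hΛ (one_mul_mul_mem_of_Vk c hc hd hk)
  have := finiteDimensional_coordLE (curve c) k
  have := finiteDimensional_Vk c k
  rw [rank_eq_rank_formRestrict_iff h0 hQ (map_Phi_Uk hc hd h0 hk) _ Λ hBQ
      (cDivT_pow_mem_twisted hc hd k) (by rw [(cDivT_pow_spec hc hd k).2.2]; exact one_ne_zero),
    rank_eq_rank_formRestrict_iff h0 hR (map_Phi_Wk hc hd h0 hk) _ Λ hBR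
      (dDivT_mem_twisted hc hd hk) (by rw [coeff_dDivT hc hd k]; norm_num)]
  rw [← hγdef] at hQ hR ⊢
  have hmem : ∀ f, Phi c f ∈ (CoordLE (curve c) (2 * k)).map (Phi c).toLinearMap →
      f ∈ CoordLE (curve c) (2 * k) := by
    rintro f ⟨g, hg, hgf⟩
    rwa [← Phi_injective h0 hgf]
  constructor
  · intro hM
    refine ⟨fun g _ => ?_, fun g _ => ?_, ?_⟩
    · have := one_mul_mul_mem_coordLE _ g.2 _ g.2
      rw [one_mul] at this
      rw [hBQ, ← map_mul, hΛ _ this]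
      exact hM.apply_sq_nonneg hL _ _
    · have := one_mul_mul_mem_of_Vk c hc hd hk g g.2 g g.2
      rw [one_mul] at this
      rw [hBR, ← map_mul, hΛ _ this]
      exact hM.apply_sq_nonneg hL _ _
    -- An isotropic `f` vanishes almost everywhere. The cofactor `h` need not lie in either test
    -- space; only the product must have a defined value.
    have hstar : ∀ s : ℝ, s * s = c.coeff 0 ^ (2 * k) → ∀ f ∈ twisted (-k) (2 * k) s,
        Λ (f * f) = 0 → ∀ h, f * h ∈ twisted (-k + -k) (2 * k + 2 * k) (γ * γ) →
          Λ (f * h) = 0 := by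
      intro s hs f hf hz h hh
      have hff := mul_mem_twisted hf hf
      rw [twisted_double k hs, ← hT] at hff
      rw [twisted_double k hγγ, ← hT] at hh
      obtain ⟨f, rfl⟩ := Phi_surjective hc hd h0 f
      obtain ⟨h, rfl⟩ := Phi_surjective hc hd h0 h
      rw [← map_mul] at hff hh hz ⊢
      rw [hΛ _ (hmem _ hh)]
      rw [hΛ _ (hmem _ hff)] at hz
      exact hM.apply_mul_eq_zero hL f h _ _ hz
    obtain ⟨f, hf0, hf, hz⟩ := exists_isotropic_of_not_isNonsingular hc hd hk hL hsing
    obtain ⟨s, hs, hss, hft⟩ : ∃ s : ℝ, (s = γ ∨ s = -γ) ∧ s * s = γ * γ ∧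
        Phi c f ∈ twisted (-k) (2 * k) s := by
      rcases hf with hf | hf
      · exact ⟨γ, Or.inl rfl, rfl, hQ ▸ Submodule.mem_map_of_mem hf⟩
      · exact ⟨-γ, Or.inr rfl, neg_mul_neg _ _, hR ▸ Submodule.mem_map_of_mem hf⟩
    have hff := mul_mem_twisted hft hft
    rw [twisted_double k (hss.trans hγγ), ← hT, ← map_mul] at hff
    have hz' : Λ (Phi c f * Phi c f) = 0 := by
      rw [← map_mul, hΛ _ (hmem _ hff), hz]
    by_cases hb : (Phi c f).coeff (2 * k) = 0
    · have hfb : Phi c f ∈ band (-k + 1) (2 * k - 1) := by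
        intro n hn
        by_cases h1 : n = -k
        · rw [h1, hft.2, hb, mul_zero]
        by_cases h2 : n = 2 * k
        · rw [h2, hb]
        exact hft.1 n (by omega)
      -- An isotropic `f` in the inner band, from either space, is multiplied up to an element of
      -- factor `γ` with nonzero top coefficient, which gives (a).
      obtain ⟨m, hm, hmb⟩ := exists_mul_mem_twisted γ hfb
        (fun h => hf0 (Phi_injective h0 (h.trans (map_zero _).symm)))
      refine Or.inl ⟨_, hm, hmb, fun g hg => ?_⟩
      rw [mul_assoc]
      apply hstar s (hss.trans hγγ) _ hft hz'
      rw [← mul_assoc]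
      exact mul_mem_twisted hm hg
    · have hker : ∀ g ∈ twisted (-k) (2 * k) s, Λ (Phi c f * g) = 0 := fun g hg =>
        hstar s (hss.trans hγγ) _ hft hz' g (hss ▸ mul_mem_twisted hft hg)
      rcases hs with rfl | rfl
      · exact Or.inl ⟨_, hft, hb, hker⟩
      · exact Or.inr ⟨_, hft, hb, hker⟩
  · rintro ⟨hposQ, hposR, hker⟩
    have hpQ : ∀ g ∈ twisted (-k) (2 * k) γ, 0 ≤ Λ (g * g) := by
      intro g hg
      obtain ⟨x, hx, rfl⟩ := hQ ▸ hg
      by_cases h : (⟨x, hx⟩ : CoordLE (curve c) k) = 0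
      · have hx0 : x = 0 := congrArg Subtype.val h
        simp [hx0]
      · have := hposQ _ h
        rwa [hBQ] at this
    have hpR : ∀ g ∈ twisted (-k) (2 * k) (-γ), 0 ≤ Λ (g * g) := by
      intro g hg
      obtain ⟨x, hx, rfl⟩ := hR ▸ hg
      by_cases h : (⟨x, hx⟩ : Vk c k) = 0
      · have hx0 : x = 0 := congrArg Subtype.val h
        simp [hx0]
      · have := hposR _ h
        rwa [hBR] at this
    obtain ⟨t, w, hw, hrep⟩ : ∃ (t : Finset ℝˣ) (w : ℝˣ → ℝ), (∀ u ∈ t, 0 ≤ w u) ∧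
        ∀ g ∈ twisted (-(2 * k : ℕ)) (2 * (2 * k : ℕ)) (c.coeff 0 ^ (2 * k)),
          Λ g = ∑ u ∈ t, w u * LaurentPolynomial.eval₂ (RingHom.id ℝ) u g := by
      -- A kernel element of one form is combined with positivity of the other.
      rcases hker with ⟨f, hf, hfb, hk⟩ | ⟨f, hf, hfb, hk⟩
      · rw [← twisted_double k hγγ]
        exact exists_atomic_on_twisted hγ Λ hf hfb hk hpR
      · rw [← twisted_double k ((neg_mul_neg γ γ).trans hγγ)]
        exact exists_atomic_on_twisted (neg_ne_zero.2 hγ) Λ hf hfb hk (by rwa [neg_neg])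
    refine isMomentFunctional_of_atomic t w hw fun p => ?_
    have hp : resMap (curve c) (p : MvPolynomial (Fin 2) ℝ) ∈ CoordLE (curve c) (2 * k) :=
      ⟨p, p.2, rfl⟩
    have h1 : Phi c (resMap (curve c) (p : MvPolynomial (Fin 2) ℝ)) ∈
        twisted (-(2 * k : ℕ)) (2 * (2 * k : ℕ)) (c.coeff 0 ^ (2 * k)) :=
      hT ▸ Submodule.mem_map_of_mem hp
    rw [← Phi_resMap, ← inducedFunctional_resLE L hL, ← hrep _ h1, hΛ _ hp]
    rfl
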